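/- Let $d\ge 1$ be an integer and let $\mathbf S^d\subset\mathbf R^{d+1}$ be the unit sphere with geodesic distance $\rho(x,y)=\arccos(x\cdot y)$. Put $\Lambda(x,y)=\frac2\pi\min\{\rho(x,y),\pi-\rho(x,y)\}$ and, for a Borel probability measure $\mu\in\mathcal P(\mathbf S^d)$ and $\alpha\in(0,\infty]$, $E_\alpha(\mu)=\frac12\iint\Lambda^\alpha(x,y)\,d\mu(x)\,d\mu(y)$, where $\Lambda^\infty(x,y)=1$ if $x\cdot y=0$ and $\Lambda^\infty(x,y)=0$ otherwise. Let $\mathcal P^=_\Delta(\mathbf S^d)$ be the set of $\mu\in\mathcal P(\mathbf S^d)$ for which there are a measure $\nu$ equidistributed over an orthonormal basis of $\mathbf R^{d+1}$ (its support is such a basis, each element of which has mass $\frac1{d+1}$) and a rotation $M\in SO(d+1)$ with $\mu(A\cup -A)=\nu(M(A\cup -A))$ for all open $A\subset\mathbf S^d$. Let the threshold exponent $\alpha_{\Delta^d}\in[0,\infty]$ be the infimum of those $\alpha\in(0,\infty)$ for which some $\hat\mu\in\mathcal P^=_\Delta(\mathbf S^d)$ maximizes $E_\alpha$ over $\mathcal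 P(\mathbf S^d)$ (with $\inf\emptyset=\infty$). Let $\mathbf{RP}^d=\mathbf S^d/\{\pm\}$ with the distance $\tilde\rho(\{x,-x\},\{y,-y\})=\min\{\rho(x,y),\pi-\rho(x,y)\}$, and equip $\mathcal P(\mathbf{RP}^d)$ with the topology of the metric $$d_\infty(\mu,\nu)=\inf_{\gamma\in\Gamma(\mu,\nu)}\ \sup_{(p,q)\in\operatorname{spt}\gamma}\tilde\rho(p,q),$$ where $\Gamma(\mu,\nu)$ is the set of Borel probability measures on $\mathbf{RP}^d\times\mathbf{RP}^d$ with left and right marginals $\mu$ and $\nu$. If the set of push-forwards to $\mathbf{RP}^d$, under $x\mapsto\{x,-x\}$, of the maximizers of $E_{\alpha_{\Delta^d}}$ over $\mathcal P(\mathbf S^d)$ is a $d_\infty$-connected subset of $\mathcal P(\mathbf{RP}^d)$, then $\alpha_{\Delta^d}=1$, i.e. the continuous Fejes Tóth conjecture holds in dimension $d$. -/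

import Mathlib

open MeasureTheory Set
open scoped ENNReal RealInnerProductSpace Pointwise

namespace FejesToth

noncomputable section

/-- Euclidean space `ℝ^(d+1)`. -/
abbrev Euc (d : ℕ) : Type := EuclideanSpace ℝ (Fin (d + 1))

/-- The unit sphere `S^d` of `ℝ^(d+1)`, with its Borel σ-algebra. -/
abbrev Sph (d : ℕ) : Type := Metric.sphere (0 : Euc d) 1

/-- The geodesic distance `ρ(x, y) = arccos (x ⬝ y)` on `S^d`. -/
def rho {d : ℕ} (x y : Sph d) : ℝ := Real.arccos ⟪(x : Euc d), (y : Euc d)⟫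

/-- `Λ₀(t) = (2/π) min {t, π - t}`. -/
def Lambda0 (t : ℝ) : ℝ := 2 / Real.pi * min t (Real.pi - t)

/-- `Λ(x, y) = Λ₀(ρ(x, y))`. -/
def Lambda {d : ℕ} (x y : Sph d) : ℝ := Lambda0 (rho x y)

/-- The kernel `Λ^α(x, y)` for an exponent `α ∈ (0, ∞]`, where `Λ^∞(x, y)` is `1` if
`x ⬝ y = 0` and `0` otherwise. -/
def kernel {d : ℕ} (α : ℝ≥0∞) (x y : Sph d) : ℝ :=
  open Classical in
  if α = ⊤ then (if ⟪(x : Euc d), (y : Euc d)⟫ = 0 then 1 else 0)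
  else Lambda x y ^ α.toReal

/-- The energy `E_α(μ) = (1/2) ∬ Λ^α(x, y) dμ(x) dμ(y)` of a Borel probability measure on `S^d`. -/
def energy {d : ℕ} (α : ℝ≥0∞) (μ : ProbabilityMeasure (Sph d)) : ℝ :=
  1 / 2 * ∫ y, ∫ x, kernel α x y ∂(μ : Measure (Sph d)) ∂(μ : Measure (Sph d))

/-- The set of maximizers of `E_α` over all Borel probability measures on `S^d`. -/
def argmaxEnergy (d : ℕ) (α : ℝ≥0∞) : Set (ProbabilityMeasure (Sph d)) :=
  {μ | ∀ ν : ProbabilityMeasure (Sph d), energy α ν ≤ energy α μ}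

/-- The action of a linear isometry of `ℝ^(d+1)` on `S^d`. -/
def rotate {d : ℕ} (M : Euc d ≃ₗᵢ[ℝ] Euc d) (x : Sph d) : Sph d :=
  ⟨M x, by simp⟩

/-- Essential equivalence `μ ≡ ν`: for some rotation `M` of `ℝ^(d+1)` one has
`μ(A ∪ -A) = ν(M(A ∪ -A))` for every open subset `A` of `S^d`. -/
def EssEquiv {d : ℕ} (μ ν : ProbabilityMeasure (Sph d)) : Prop :=
  ∃ M : Euc d ≃ₗᵢ[ℝ] Euc d,
    LinearMap.det (M.toLinearEquiv : Euc d →ₗ[ℝ] Euc d) = 1 ∧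
    ∀ A : Set (Sph d), IsOpen A →
      (μ : Measure (Sph d)) (A ∪ -A) = (ν : Measure (Sph d)) (rotate M '' (A ∪ -A))

/-- Probability measures on `S^d` whose support is an orthonormal basis of `ℝ^(d+1)` and which
give mass `1/(d+1)` to each of its elements. -/
def PonEq (d : ℕ) : Set (ProbabilityMeasure (Sph d)) :=
  {μ | (∃ b : OrthonormalBasis (Fin (d + 1)) ℝ (Euc d),
          (fun x : Sph d => (x : Euc d)) '' (μ : Measure (Sph d)).support = range b) ∧
        ∀ x ∈ (μ : Measure (Sph d)).support,
          (μ : Measure (Sph d)) {x} = ((d : ℝ≥0∞) + 1)⁻¹}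

/-- Probability measures on `S^d` that are essentially equivalent to an equidistribution over an
orthonormal basis. -/
def PDeltaEq (d : ℕ) : Set (ProbabilityMeasure (Sph d)) :=
  {μ | ∃ ν ∈ PonEq d, EssEquiv μ ν}

/-- The threshold exponent: the infimum, in `[0, ∞]`, of those `α ∈ (0, ∞)` for which some
measure that equidistributes its mass over an orthonormal basis (up to essential equivalence)
maximizes `E_α`; it is `∞` if there is no such `α`. -/
def thresholdExponent (d : ℕ) : ℝ≥0∞ :=
  sInf {α : ℝ≥0∞ | 0 < α ∧ α < ⊤ ∧ (PDeltaEq d ∩ argmaxEnergy d α).Nonempty}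

theorem ponEq_nonempty (d : ℕ) : (PonEq d).Nonempty := by
  classical
  let b : OrthonormalBasis (Fin (d+1)) ℝ (Euc d) := EuclideanSpace.basisFun _ ℝ
  let p : Fin (d+1) → Sph d := fun i => ⟨b i, by simp⟩
  have hp : Function.Injective p := fun i j h => b.toBasis.injective (by
    simpa using congrArg Subtype.val h)
  let m : Measure (Sph d) := ∑ i, ((d : ℝ≥0∞) + 1)⁻¹ • Measure.dirac (p i)
  have hm : ∀ s, MeasurableSet s → m s = ∑ i, ((d : ℝ≥0∞) + 1)⁻¹ * s.indicator 1 (p i) := by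
    intro s hs
    simp [m, Measure.finsetSum_apply, hs]
  have h1 : m univ = 1 := by
    rw [hm _ MeasurableSet.univ]
    simp
    exact ENNReal.mul_inv_cancel (by simp) (by simp)
  have hm0 : ∀ i, m {p i} = ((d : ℝ≥0∞) + 1)⁻¹ := by
    intro i
    rw [hm _ (measurableSet_singleton _), Finset.sum_eq_single i]
    · simp
    · intro j _ hj
      simp [hp.eq_iff, hj]
    · simp
  have hsupp : m.support = Set.range p := by
    ext x
    constructor
    · intro hx
      by_contra hn
      have hc : IsOpen (Set.range p)ᶜ := (Set.finite_range p).isClosed.isOpen_compl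
      have := ((nhds_basis_opens x).mem_measureSupport.1 hx) _ ⟨hn, hc⟩
      rw [hm _ hc.measurableSet] at this
      simp at this
    · rintro ⟨i, rfl⟩
      refine (nhds_basis_opens _).mem_measureSupport.2 ?_
      rintro s ⟨hs, ho⟩
      refine lt_of_lt_of_le ?_ (measure_mono (Set.singleton_subset_iff.2 hs))
      rw [hm0]; simp
  refine ⟨⟨m, ⟨h1⟩⟩, ⟨b, ?_⟩, ?_⟩
  · change _ '' m.support = _
    rw [hsupp, ← Set.range_comp]; rfl
  · change ∀ x ∈ m.support, m {x} = _
    rw [hsupp]; rintro _ ⟨i, rfl⟩; exact hm0 i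

theorem pDeltaEq_nonempty (d : ℕ) : (PDeltaEq d).Nonempty := by
  obtain ⟨μ, hμ⟩ := ponEq_nonempty d
  refine ⟨μ, μ, hμ, LinearIsometryEquiv.refl ℝ _, ?_, ?_⟩
  · exact LinearMap.det_id
  · intro A _
    have : (rotate (LinearIsometryEquiv.refl ℝ (Euc d))) = id := rfl
    rw [this, image_id]

/-- If a number `a` is such that for `0 < α < a` no equidistribution over a maximal simplex
maximizes `E_α`, while for `α > a` the maximizers of `E_α` are precisely these equidistributions,
then `a` is the threshold exponent. -/
theorem eq_thresholdExponent {d : ℕ} {a : ℝ≥0∞}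
    (hlt : ∀ α : ℝ≥0∞, 0 < α → α < a → Disjoint (PDeltaEq d) (argmaxEnergy d α))
    (hgt : ∀ α : ℝ≥0∞, a < α → PDeltaEq d = argmaxEnergy d α) :
    a = thresholdExponent d := by
  refine le_antisymm (le_sInf ?_) (le_of_forall_gt fun c hc => ?_)
  · rintro α ⟨h0, _, h⟩
    by_contra hn
    exact Set.not_disjoint_iff_nonempty_inter.2 h (hlt α h0 (not_le.1 hn))
  · obtain ⟨α, h1, h2⟩ := exists_between hc
    refine lt_of_le_of_lt (sInf_le ⟨h1.bot_lt, lt_top_of_lt h2, ?_⟩) h2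
    rw [← hgt α h1, Set.inter_self]
    exact pDeltaEq_nonempty d

/-- Identification of antipodal points of `S^d`. -/
def antipodal (d : ℕ) : Setoid (Sph d) where
  r x y := x = y ∨ x = -y
  iseqv :=
    { refl := fun _ => Or.inl rfl
      symm := by
        rintro x y (h | h)
        · exact Or.inl h.symm
        · exact Or.inr (by rw [h, neg_neg])
      trans := by
        rintro x y z (rfl | rfl) (rfl | rfl)
        · exact Or.inl rfl
        · exact Or.inr rfl
        · exact Or.inr rfl
        · exact Or.inl (neg_neg z) }

/-- Real projective space `ℝP^d = S^d / {±}`. -/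
def RP (d : ℕ) : Type := Quotient (antipodal d)

/-- The quotient topology on `ℝP^d`. -/
instance (d : ℕ) : TopologicalSpace (RP d) :=
  inferInstanceAs (TopologicalSpace (Quotient (antipodal d)))

/-- The Borel σ-algebra on `ℝP^d`. -/
instance (d : ℕ) : MeasurableSpace (RP d) := borel (RP d)

instance (d : ℕ) : BorelSpace (RP d) := ⟨rfl⟩

/-- The covering map `S^d → ℝP^d`, `x ↦ {x, -x}`. -/
def toRP {d : ℕ} (x : Sph d) : RP d := Quotient.mk (antipodal d) x

theorem continuous_toRP {d : ℕ} : Continuous (toRP : Sph d → RP d) :=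
  continuous_quotient_mk'

theorem rho_neg_right {d : ℕ} (x y : Sph d) : rho x (-y) = Real.pi - rho x y := by
  simp [rho, Real.arccos_neg]

theorem rho_neg_left {d : ℕ} (x y : Sph d) : rho (-x) y = Real.pi - rho x y := by
  simp [rho, Real.arccos_neg]

/-- The geodesic distance on `ℝP^d`: the distance between `{x, -x}` and `{y, -y}` is
`min {ρ(x, y), π - ρ(x, y)}`. -/
def rhoRP {d : ℕ} : RP d → RP d → ℝ :=
  Quotient.lift₂ (s₁ := antipodal d) (s₂ := antipodal d)
    (fun x y => min (rho x y) (Real.pi - rho x y)) (by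
      rintro a b a' b' (rfl | rfl) (rfl | rfl) <;>
        simp [rho_neg_left, rho_neg_right, min_comm])

/-- The image of a probability measure on `S^d` under the covering map. -/
def projMeasure {d : ℕ} (μ : ProbabilityMeasure (Sph d)) : ProbabilityMeasure (RP d) :=
  μ.map (f := toRP) continuous_toRP.measurable.aemeasurable

/-- The set `Γ(μ, ν)` of joint probability measures on `ℝP^d × ℝP^d` with left marginal `μ` and
right marginal `ν`. -/
def couplings {d : ℕ} (μ ν : ProbabilityMeasure (RP d)) :
    Set (ProbabilityMeasure (RP d × RP d)) :=
  {γ | (γ : Measure (RP d × RP d)).map Prod.fst = (μ : Measure (RP d)) ∧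
       (γ : Measure (RP d × RP d)).map Prod.snd = (ν : Measure (RP d))}

/-- The `L^∞`-Kantorovich–Rubinstein–Wasserstein distance on probability measures on `ℝP^d`:
the infimum over `γ ∈ Γ(μ, ν)` of the supremum of the distance over the support of `γ`. -/
def dInfty {d : ℕ} (μ ν : ProbabilityMeasure (RP d)) : ℝ :=
  sInf ((fun γ : ProbabilityMeasure (RP d × RP d) =>
      sSup ((fun p : RP d × RP d => rhoRP p.1 p.2) ''
        (γ : Measure (RP d × RP d)).support)) '' couplings μ ν)

/-- The `d_∞`-topology on probability measures on `ℝP^d`, generated by the open `d_∞`-balls.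
(It is not the topology of narrow convergence that Mathlib puts on `ProbabilityMeasure`.) -/
@[reducible] def dInftyTopology (d : ℕ) : TopologicalSpace (ProbabilityMeasure (RP d)) :=
  TopologicalSpace.generateFrom
    {U | ∃ (μ : ProbabilityMeasure (RP d)) (r : ℝ), U = {ν | dInfty μ ν < r}}

end

end FejesToth

namespace FejesToth

open Filter Topology

/-! An equidistribution over a frame has `doubleEnergy` d/(d+1) at every exponent α > 0, and energy
is nonincreasing in α because 0 ≤ Λ ≤ 1. Hence some measure exceeds d/(d+1) at each exponent below
the threshold a, none does beyond it, and by continuity in α none does at a. The Euler–Lagrange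
condition at the midpoint of two frame vectors gives a ≥ 1; a second-moment bound gives a ≤ 2, so a
is finite.

Suppose a > 1. Two facts hold at each fixed exponent above 1. (1) `exists_radius_local_maximality`:
a measure carried by r-neighbourhoods of the lines of a frame has energy at most d/(d+1), with
equality only for equidistributions, and r does not depend on the frame. Spreading a cluster gains
at most a factor (4r)^(α-1) times its mean internal Λ, but spoils orthogonality to the other
clusters at a linear cost that dominates this gain. (2) `exists_Lambda_eq_zero_of_le_sum_rpow`: the
potential of an equidistribution reaches d/(d+1) only on the frame lines.

By (1) at a, the equidistributions are open and closed among the maximizers for d_∞, so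
connectedness makes every maximizer of E_a an equidistribution. Let α increase to a, with maximizers
M α of energy above d/(d+1). A narrow cluster point maximizes E_a, hence is an equidistribution. Fix
β in (1, a). By (2), compactness and the Euler–Lagrange equation, some M α with β < α < a is carried
by small neighbourhoods of the frame lines; then (1) at β bounds its energy by d/(d+1), a
contradiction. -/

/-! ### Trigonometric inequalities for Λ -/

theorem arcsin_sqrt_add_le {s t : ℝ} (hs : 0 ≤ s) (ht : 0 ≤ t) (h : s ^ 2 + t ^ 2 ≤ 1) :
    Real.arcsin (√(s ^ 2 + t ^ 2)) ≤ Real.arcsin s + Real.arcsin t := by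
  have hs1 : s ≤ 1 := by nlinarith
  have ht1 : t ≤ 1 := by nlinarith
  have hA := Real.arcsin_nonneg.2 hs
  have hB := Real.arcsin_nonneg.2 ht
  rcases le_or_gt (Real.pi / 2) (Real.arcsin s + Real.arcsin t) with h2 | h2
  · exact (Real.arcsin_le_pi_div_two _).trans h2
  · rw [Real.arcsin_le_iff_le_sin' ⟨by linarith [Real.pi_pos], h2⟩]
    · refine Real.sqrt_le_iff.2 ⟨Real.sin_nonneg_of_nonneg_of_le_pi (by linarith)
        (by linarith [Real.pi_pos]), ?_⟩
      have hc := Real.cos_nonneg_of_neg_pi_div_two_le_of_le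
        (by linarith [Real.pi_pos] : -(Real.pi / 2) ≤ Real.arcsin s + Real.arcsin t) h2.le
      have h1 := Real.sin_arcsin (by linarith : -1 ≤ s) hs1
      have h3 := Real.sin_arcsin (by linarith : -1 ≤ t) ht1
      have e1 := Real.sin_sq_add_cos_sq (Real.arcsin s)
      have e2 := Real.sin_sq_add_cos_sq (Real.arcsin t)
      rw [Real.cos_add, h1, h3] at hc
      rw [h1] at e1
      rw [h3] at e2
      rw [Real.sin_add, h1, h3]
      -- With A, B the two arcsines, sin²(A + B) = s² + t² + 2st cos(A + B), and the last term is
      -- nonnegative.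
      have := mul_nonneg (mul_nonneg hs ht) hc
      have e1' : Real.cos (Real.arcsin s) ^ 2 = 1 - s ^ 2 := by linarith
      have e2' : Real.cos (Real.arcsin t) ^ 2 = 1 - t ^ 2 := by linarith
      nlinarith

theorem arcsin_sqrt_sum_le {ι : Type*} (S : Finset ι) (t : ι → ℝ) (ht : ∀ i, 0 ≤ t i)
    (h : ∑ i ∈ S, t i ^ 2 ≤ 1) :
    Real.arcsin (√(∑ i ∈ S, t i ^ 2)) ≤ ∑ i ∈ S, Real.arcsin (t i) := by
  classical
  induction S using Finset.induction_on with
  | empty => simp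
  | insert i S hi ih =>
    rw [Finset.sum_insert hi] at h ⊢
    rw [Finset.sum_insert hi]
    have h0 : 0 ≤ ∑ i ∈ S, t i ^ 2 := Finset.sum_nonneg fun _ _ => sq_nonneg _
    have := ih (by nlinarith [sq_nonneg (t i)])
    have h2 := arcsin_sqrt_add_le (ht i) (Real.sqrt_nonneg (∑ i ∈ S, t i ^ 2))
      (by rwa [Real.sq_sqrt h0])
    rw [Real.sq_sqrt h0] at h2
    linarith

variable {d : ℕ}

theorem abs_inner_le_one (x y : Sph d) : |⟪(x : Euc d), (y : Euc d)⟫| ≤ 1 := by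
  simpa using abs_real_inner_le_norm (x : Euc d) (y : Euc d)

theorem Lambda_eq (x y : Sph d) :
    Lambda x y = 2 / Real.pi * Real.arccos |⟪(x : Euc d), (y : Euc d)⟫| := by
  unfold Lambda Lambda0 rho
  congr 1
  rcases le_total 0 ⟪(x : Euc d), (y : Euc d)⟫ with h | h
  · rw [abs_of_nonneg h, min_eq_left]
    linarith [Real.arccos_le_pi_div_two.2 h]
  · rw [abs_of_nonpos h, Real.arccos_neg, min_eq_right]
    have := Real.arccos_le_pi_div_two.2 (neg_nonneg.2 h)
    rw [Real.arccos_neg] at this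
    linarith

theorem Lambda_nonneg (x y : Sph d) : 0 ≤ Lambda x y := by
  rw [Lambda_eq]
  have := Real.arccos_nonneg |⟪(x : Euc d), (y : Euc d)⟫|
  have := Real.pi_pos
  positivity

theorem Lambda_eq_one_sub (x y : Sph d) :
    Lambda x y = 1 - 2 / Real.pi * Real.arcsin |⟪(x : Euc d), (y : Euc d)⟫| := by
  rw [Lambda_eq, Real.arccos_eq_pi_div_two_sub_arcsin]
  have := Real.pi_ne_zero
  field_simp

/-- From u ≤ arcsin u and π ≤ 4. The loss is linear in |x ⬝ y|, which is what lets it dominate the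
spread of a cluster later. -/
theorem Lambda_le_one_sub (x y : Sph d) :
    Lambda x y ≤ 1 - 1 / 2 * |⟪(x : Euc d), (y : Euc d)⟫| := by
  rw [Lambda_eq_one_sub]
  have h0 := abs_nonneg ⟪(x : Euc d), (y : Euc d)⟫
  have h1 := abs_inner_le_one x y
  have h := Real.sin_le (Real.arcsin_nonneg.2 h0)
  rw [Real.sin_arcsin (by linarith) h1] at h
  have h3 : 1 / 2 ≤ 2 / Real.pi := by
    rw [div_le_div_iff₀ two_pos Real.pi_pos]; linarith [Real.pi_le_four]
  nlinarith

theorem Lambda_le_one (x y : Sph d) : Lambda x y ≤ 1 := by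
  linarith [Lambda_le_one_sub x y, abs_nonneg ⟪(x : Euc d), (y : Euc d)⟫]

theorem Lambda_comm (x y : Sph d) : Lambda x y = Lambda y x := by
  rw [Lambda_eq, Lambda_eq, real_inner_comm]

theorem Lambda_neg_left (x y : Sph d) : Lambda (-x) y = Lambda x y := by
  rw [Lambda_eq, Lambda_eq]; simp

theorem Lambda_neg_right (x y : Sph d) : Lambda x (-y) = Lambda x y := by
  rw [Lambda_eq, Lambda_eq]; simp

theorem continuous_Lambda : Continuous fun p : Sph d × Sph d => Lambda p.1 p.2 := by
  simp only [Lambda_eq]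
  fun_prop

theorem Lambda_eq_one_of_inner_eq_zero {x y : Sph d} (h : ⟪(x : Euc d), (y : Euc d)⟫ = 0) :
    Lambda x y = 1 := by
  rw [Lambda_eq_one_sub, h]; simp

theorem inner_eq_zero_of_Lambda_eq_one {x y : Sph d} (h : Lambda x y = 1) :
    ⟪(x : Euc d), (y : Euc d)⟫ = 0 := by
  have := Lambda_le_one_sub x y
  exact abs_nonpos_iff.1 (by linarith)

theorem norm_sub_sq_eq (x y : Sph d) :
    ‖(x : Euc d) - y‖ ^ 2 = 2 - 2 * ⟪(x : Euc d), (y : Euc d)⟫ := by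
  rw [norm_sub_sq_real]; simp; ring

theorem Lambda_le_norm_sub (x y : Sph d) : Lambda x y ≤ ‖(x : Euc d) - y‖ := by
  have h1 := abs_le.1 (abs_inner_le_one x y)
  set t := ⟪(x : Euc d), (y : Euc d)⟫ with ht
  have hp := Real.pi_pos
  have h2 : Lambda x y ≤ 2 / Real.pi * Real.arccos t := by
    unfold Lambda Lambda0 rho
    gcongr
    exact min_le_left _ _
  refine h2.trans ?_
  have h0 := Real.arccos_nonneg t
  have h3 := Real.mul_le_sin (x := Real.arccos t / 2) (by linarith)
    (by linarith [Real.arccos_le_pi t])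
  have h4 : Real.sin (Real.arccos t / 2) ^ 2 = (1 - t) / 2 := by
    rw [Real.sin_sq_eq_half_sub, mul_div_cancel₀ _ two_ne_zero, Real.cos_arccos h1.1 h1.2]; ring
  have h5 := norm_sub_sq_eq x y
  rw [← ht] at h5
  refine abs_le_of_sq_le_sq' ?_ (norm_nonneg _) |>.2
  have h6 : 0 ≤ 2 / Real.pi * (Real.arccos t / 2) := by positivity
  have : 2 / Real.pi * Real.arccos t = 2 * (2 / Real.pi * (Real.arccos t / 2)) := by ring
  rw [this, h5]
  nlinarith

theorem norm_sub_le_Lambda {x y : Sph d} (h : 0 ≤ ⟪(x : Euc d), (y : Euc d)⟫) :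
    ‖(x : Euc d) - y‖ ≤ 2 * Lambda x y := by
  have h1 := abs_le.1 (abs_inner_le_one x y)
  rw [Lambda_eq, abs_of_nonneg h]
  have h5 := norm_sub_sq_eq x y
  set t := ⟪(x : Euc d), (y : Euc d)⟫ with ht
  have hp := Real.pi_pos
  have h0 := Real.arccos_nonneg t
  have h3 := Real.sin_le (x := Real.arccos t / 2) (by linarith)
  have h3' := Real.sin_nonneg_of_nonneg_of_le_pi (x := Real.arccos t / 2) (by linarith)
    (by linarith [Real.arccos_le_pi t])
  have h4 : Real.sin (Real.arccos t / 2) ^ 2 = (1 - t) / 2 := by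
    rw [Real.sin_sq_eq_half_sub, mul_div_cancel₀ _ two_ne_zero, Real.cos_arccos h1.1 h1.2]; ring
  have h6 : ‖(x : Euc d) - y‖ ≤ Real.arccos t := by
    refine abs_le_of_sq_le_sq' ?_ h0 |>.2
    nlinarith
  have h7 : 1 / 2 ≤ 2 / Real.pi := by
    rw [div_le_div_iff₀ two_pos Real.pi_pos]; linarith [Real.pi_le_four]
  nlinarith

theorem eq_or_eq_neg_of_Lambda_eq_zero {x y : Sph d} (h : Lambda x y = 0) : x = y ∨ x = -y := by
  rcases le_total 0 ⟪(x : Euc d), (y : Euc d)⟫ with h1 | h1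
  · left
    have := norm_sub_le_Lambda h1
    rw [h, mul_zero] at this
    exact Subtype.ext (sub_eq_zero.1 (norm_le_zero_iff.1 this))
  · right
    have := norm_sub_le_Lambda (x := x) (y := -y) (by simpa using h1)
    rw [Lambda_neg_right, h, mul_zero] at this
    exact Subtype.ext (sub_eq_zero.1 (norm_le_zero_iff.1 this))

theorem Lambda_self (x : Sph d) : Lambda x x = 0 :=
  le_antisymm (by simpa using Lambda_le_norm_sub x x) (Lambda_nonneg x x)

/-- Jordan's inequality sin u ≥ 2u/π at u = arccos |x ⬝ y|. -/
theorem Lambda_sq_le (x y : Sph d) : Lambda x y ^ 2 ≤ 1 - ⟪(x : Euc d), (y : Euc d)⟫ ^ 2 := by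
  have h0 := abs_nonneg ⟪(x : Euc d), (y : Euc d)⟫
  have h1 := abs_inner_le_one x y
  have h := Real.mul_le_sin (Real.arccos_nonneg |⟪(x : Euc d), (y : Euc d)⟫|)
    (Real.arccos_le_pi_div_two.2 h0)
  rw [← Lambda_eq, Real.sin_arccos, sq_abs] at h
  have h2 : 0 ≤ 1 - ⟪(x : Euc d), (y : Euc d)⟫ ^ 2 := by
    rw [← sq_abs]; nlinarith
  calc _ ≤ √(1 - ⟪(x : Euc d), (y : Euc d)⟫ ^ 2) ^ 2 := by
        have := Lambda_nonneg x y
        gcongr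
    _ = _ := Real.sq_sqrt h2

/-- An element of an orthonormal basis, as a point of the sphere. -/
noncomputable def basisPoint (b : OrthonormalBasis (Fin (d + 1)) ℝ (Euc d)) (i : Fin (d + 1)) : Sph d :=
  ⟨b i, by simp⟩

theorem sum_inner_basisPoint_sq (b : OrthonormalBasis (Fin (d + 1)) ℝ (Euc d)) (x : Sph d) :
    ∑ i, ⟪(x : Euc d), (basisPoint b i : Euc d)⟫ ^ 2 = 1 := by
  have := b.sum_sq_norm_inner_left (x : Euc d)
  simpa [basisPoint] using this

/-- By Parseval and subadditivity the angles arcsin |x ⬝ b i| add up to at least arcsin 1 = π/2. -/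
theorem sum_Lambda_basisPoint_le (b : OrthonormalBasis (Fin (d + 1)) ℝ (Euc d)) (x : Sph d) :
    ∑ i, Lambda x (basisPoint b i) ≤ d := by
  have h := arcsin_sqrt_sum_le Finset.univ
    (fun i => |⟪(x : Euc d), (basisPoint b i : Euc d)⟫|) (fun _ => abs_nonneg _)
  simp only [sq_abs, sum_inner_basisPoint_sq, le_refl, Real.sqrt_one, Real.arcsin_one,
    forall_const] at h
  simp only [Lambda_eq_one_sub, Finset.sum_sub_distrib, ← Finset.mul_sum]
  simp only [Finset.sum_const, Finset.card_univ, Fintype.card_fin, nsmul_eq_mul, mul_one]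
  have h2 : 2 / Real.pi * (Real.pi / 2) = 1 := by
    have := Real.pi_ne_zero
    field_simp
  have := mul_le_mul_of_nonneg_left h (by have := Real.pi_pos; positivity : 0 ≤ 2 / Real.pi)
  push_cast
  linarith

theorem Lambda_rpow_anti {α β : ℝ} (hβ : 0 < β) (h : β ≤ α) (x y : Sph d) :
    Lambda x y ^ α ≤ Lambda x y ^ β := by
  rcases (Lambda_nonneg x y).eq_or_lt with h0 | h0
  · rw [← h0, Real.zero_rpow hβ.ne', Real.zero_rpow (hβ.trans_le h).ne']
  · exact Real.rpow_le_rpow_of_exponent_ge h0 (Lambda_le_one x y) h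

theorem Lambda_rpow_le_one {α : ℝ} (hα : 0 < α) (x y : Sph d) : Lambda x y ^ α ≤ 1 :=
  Real.rpow_le_one (Lambda_nonneg x y) (Lambda_le_one x y) hα.le

/-- Equality in Λ^β ≤ Λ forces every term to be 0 or 1; if all were 1, then x would be orthogonal to
the whole basis. -/
theorem exists_Lambda_eq_zero_of_le_sum_rpow (b : OrthonormalBasis (Fin (d + 1)) ℝ (Euc d))
    {β : ℝ} (hβ : 1 < β) {x : Sph d} (h : d ≤ ∑ i, Lambda x (basisPoint b i) ^ β) :
    ∃ i, Lambda x (basisPoint b i) = 0 := by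
  have h1 : ∀ i ∈ Finset.univ, Lambda x (basisPoint b i) ^ β ≤ Lambda x (basisPoint b i) := by
    intro i _
    simpa using Lambda_rpow_anti one_pos hβ.le x (basisPoint b i)
  have h2 := (Finset.sum_eq_sum_iff_of_le h1).1
    (le_antisymm (Finset.sum_le_sum h1) ((sum_Lambda_basisPoint_le b x).trans h))
  by_contra! hn
  have h3 : ∀ i, ⟪(x : Euc d), (basisPoint b i : Euc d)⟫ = 0 := by
    intro i
    apply inner_eq_zero_of_Lambda_eq_one
    by_contra h4
    have h5 := Real.rpow_lt_rpow_of_exponent_gt ((Lambda_nonneg x _).lt_of_ne' (hn i))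
      ((Lambda_le_one x _).lt_of_ne h4) hβ
    rw [Real.rpow_one, h2 i (Finset.mem_univ i)] at h5
    exact lt_irrefl _ h5
  have := sum_inner_basisPoint_sq b x
  simp [h3] at this

/-! ### Potentials, continuity and the Euler–Lagrange conditions -/

/-- The potential `∫ Λ(x, y)^α dμ(y)`. -/
noncomputable def potential (α : ℝ) (μ : ProbabilityMeasure (Sph d)) (x : Sph d) : ℝ :=
  ∫ y, Lambda x y ^ α ∂(μ : Measure (Sph d))

/-- The double integral `∬ Λ(x, y)^α dμ(x) dμ(y)`. -/
noncomputable def doubleEnergy (α : ℝ) (μ : ProbabilityMeasure (Sph d)) : ℝ :=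
  ∫ x, potential α μ x ∂(μ : Measure (Sph d))

theorem integrable_of_continuous {X : Type*} [TopologicalSpace X] [CompactSpace X]
    [MeasurableSpace X] [OpensMeasurableSpace X] {f : X → ℝ} (hf : Continuous f)
    (μ : Measure X) [IsFiniteMeasure μ] : Integrable f μ :=
  (BoundedContinuousFunction.mkOfCompact ⟨f, hf⟩).integrable μ

theorem continuous_integral_of_continuous {X : Type*} [TopologicalSpace X] [CompactSpace X]
    [MeasurableSpace X] [OpensMeasurableSpace X] {f : X → ℝ} (hf : Continuous f) :
    Continuous fun μ : ProbabilityMeasure X => ∫ x, f x ∂(μ : Measure X) :=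
  ProbabilityMeasure.continuous_integral_boundedContinuousFunction
    (BoundedContinuousFunction.mkOfCompact ⟨f, hf⟩)

theorem continuous_Lambda_rpow {α : ℝ} (hα : 0 < α) :
    Continuous fun p : Sph d × Sph d => Lambda p.1 p.2 ^ α :=
  continuous_Lambda.rpow_const fun _ => Or.inr hα.le

theorem continuous_Lambda_rpow_right {α : ℝ} (hα : 0 < α) (x : Sph d) :
    Continuous fun y => Lambda x y ^ α :=
  (continuous_Lambda.comp (Continuous.prodMk_right x)).rpow_const fun _ => Or.inr hα.le

theorem energy_eq {α : ℝ≥0∞} (hα : α ≠ ⊤) (μ : ProbabilityMeasure (Sph d)) :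
    energy α μ = 1 / 2 * doubleEnergy α.toReal μ := by
  simp only [energy, kernel, hα, if_false, doubleEnergy, potential]
  congr 1
  refine integral_congr_ae (.of_forall fun y => integral_congr_ae (.of_forall fun x => ?_))
  simp only [Lambda_comm x y]

theorem mem_argmaxEnergy_iff {α : ℝ≥0∞} (hα : α ≠ ⊤) (μ : ProbabilityMeasure (Sph d)) :
    μ ∈ argmaxEnergy d α ↔ ∀ ν : ProbabilityMeasure (Sph d), doubleEnergy α.toReal ν ≤ doubleEnergy α.toReal μ := by
  simp only [argmaxEnergy, mem_ofPred_eq, energy_eq hα]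
  refine forall_congr' fun ν => ?_
  constructor <;> intro h <;> linarith

/-- The potential is the integral of Λ^α against δ_x ⊗ μ, which depends continuously on (μ, x) in
the narrow topology. -/
theorem continuous_potential {α : ℝ} (hα : 0 < α) :
    Continuous fun p : ProbabilityMeasure (Sph d) × Sph d => potential α p.1 p.2 := by
  have h1 := continuous_integral_of_continuous (continuous_Lambda_rpow (d := d) hα)
  have h2 : Continuous fun p : ProbabilityMeasure (Sph d) × Sph d =>
      (diracProba p.2).prod p.1 :=
    ProbabilityMeasure.continuous_prod.comp
      ((continuous_diracProba.comp continuous_snd).prodMk continuous_fst)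
  refine (h1.comp h2).congr fun p => ?_
  simp only [Function.comp, ProbabilityMeasure.toMeasure_prod, potential]
  rw [integral_prod _ (integrable_of_continuous (continuous_Lambda_rpow hα) _)]
  simp [diracProba]

theorem continuous_potential_right {α : ℝ} (hα : 0 < α) (μ : ProbabilityMeasure (Sph d)) :
    Continuous (potential α μ) :=
  (continuous_potential hα).comp (by fun_prop : Continuous fun x => (μ, x))

theorem integrable_potential {α : ℝ} (hα : 0 < α) (μ : ProbabilityMeasure (Sph d))
    (ν : Measure (Sph d)) [IsFiniteMeasure ν] : Integrable (potential α μ) ν :=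
  integrable_of_continuous (continuous_potential_right hα μ) ν

theorem doubleEnergy_eq_integral_prod {α : ℝ} (hα : 0 < α) (μ : ProbabilityMeasure (Sph d)) :
    doubleEnergy α μ =
      ∫ p : Sph d × Sph d, Lambda p.1 p.2 ^ α ∂((μ : Measure (Sph d)).prod μ) := by
  rw [integral_prod _ (integrable_of_continuous (continuous_Lambda_rpow hα) _)]
  rfl

theorem continuous_doubleEnergy {α : ℝ} (hα : 0 < α) :
    Continuous fun μ : ProbabilityMeasure (Sph d) => doubleEnergy α μ := by
  have h1 := continuous_integral_of_continuous (continuous_Lambda_rpow (d := d) hα)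
  have h2 : Continuous fun μ : ProbabilityMeasure (Sph d) => μ.prod μ :=
    ProbabilityMeasure.continuous_prod.comp (continuous_id.prodMk continuous_id)
  exact (h1.comp h2).congr fun μ => (doubleEnergy_eq_integral_prod hα μ).symm

theorem potential_anti {α β : ℝ} (hβ : 0 < β) (h : β ≤ α) (μ : ProbabilityMeasure (Sph d))
    (x : Sph d) : potential α μ x ≤ potential β μ x :=
  integral_mono (integrable_of_continuous (continuous_Lambda_rpow_right (hβ.trans_le h) x) _)
    (integrable_of_continuous (continuous_Lambda_rpow_right hβ x) _)
    fun y => Lambda_rpow_anti hβ h x y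

theorem doubleEnergy_anti {α β : ℝ} (hβ : 0 < β) (h : β ≤ α) (μ : ProbabilityMeasure (Sph d)) :
    doubleEnergy α μ ≤ doubleEnergy β μ :=
  integral_mono (integrable_potential (hβ.trans_le h) μ _) (integrable_potential hβ μ _)
    fun x => potential_anti hβ h μ x

theorem continuousAt_doubleEnergy_exponent {α : ℝ} (hα : 0 < α)
    (μ : ProbabilityMeasure (Sph d)) : ContinuousAt (fun β => doubleEnergy β μ) α := by
  have h : ContinuousAt (fun β =>
      ∫ p : Sph d × Sph d, Lambda p.1 p.2 ^ β ∂((μ : Measure (Sph d)).prod μ)) α := by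
    refine continuousAt_of_dominated (bound := fun _ => 1) ?_ ?_ (integrable_const 1) ?_
    · filter_upwards [lt_mem_nhds hα] with β hβ
      exact (continuous_Lambda_rpow hβ).aestronglyMeasurable
    · filter_upwards [lt_mem_nhds hα] with β hβ
      refine .of_forall fun p => ?_
      rw [Real.norm_of_nonneg (Real.rpow_nonneg (Lambda_nonneg _ _) _)]
      exact Lambda_rpow_le_one hβ _ _
    · exact .of_forall fun p => (Real.continuousAt_const_rpow' hα.ne')
  refine h.congr ?_
  filter_upwards [lt_mem_nhds hα] with β hβ
  exact (doubleEnergy_eq_integral_prod hβ μ).symm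

/-- The convex combination `(1 - t) μ + t δ_x`. -/
noncomputable def mixDirac (μ : ProbabilityMeasure (Sph d)) (x : Sph d) {t : ℝ} (h0 : 0 ≤ t)
    (h1 : t ≤ 1) : ProbabilityMeasure (Sph d) :=
  ⟨ENNReal.ofReal (1 - t) • (μ : Measure (Sph d)) + ENNReal.ofReal t • Measure.dirac x, ⟨by
    simp only [Measure.coe_add, Measure.coe_smul, Pi.add_apply, Pi.smul_apply, measure_univ,
      smul_eq_mul, mul_one]
    rw [← ENNReal.ofReal_add (by linarith) h0]
    simp⟩⟩

theorem integral_mixDirac (μ : ProbabilityMeasure (Sph d)) (x : Sph d) {t : ℝ} (h0 : 0 ≤ t)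
    (h1 : t ≤ 1) {f : Sph d → ℝ} (hf : Continuous f) :
    ∫ y, f y ∂(mixDirac μ x h0 h1 : Measure (Sph d)) =
      (1 - t) * ∫ y, f y ∂(μ : Measure (Sph d)) + t * f x := by
  change ∫ y, f y ∂(ENNReal.ofReal (1 - t) • (μ : Measure (Sph d)) +
    ENNReal.ofReal t • Measure.dirac x) = _
  rw [integral_add_measure
    ((integrable_of_continuous hf _).smul_measure ENNReal.ofReal_ne_top)
    ((integrable_of_continuous hf _).smul_measure ENNReal.ofReal_ne_top),
    integral_smul_measure, integral_smul_measure, integral_dirac,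
    ENNReal.toReal_ofReal (by linarith), ENNReal.toReal_ofReal h0]
  rfl

theorem potential_mixDirac {α : ℝ} (hα : 0 < α) (μ : ProbabilityMeasure (Sph d)) (x : Sph d)
    {t : ℝ} (h0 : 0 ≤ t) (h1 : t ≤ 1) (z : Sph d) :
    potential α (mixDirac μ x h0 h1) z = (1 - t) * potential α μ z + t * Lambda z x ^ α :=
  integral_mixDirac μ x h0 h1 (continuous_Lambda_rpow_right hα z)

theorem doubleEnergy_mixDirac {α : ℝ} (hα : 0 < α) (μ : ProbabilityMeasure (Sph d)) (x : Sph d)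
    {t : ℝ} (h0 : 0 ≤ t) (h1 : t ≤ 1) :
    doubleEnergy α (mixDirac μ x h0 h1) =
      (1 - t) ^ 2 * doubleEnergy α μ + 2 * t * (1 - t) * potential α μ x := by
  unfold doubleEnergy
  rw [integral_mixDirac _ _ _ _ (continuous_potential_right hα _)]
  simp only [potential_mixDirac hα, Lambda_comm _ x]
  rw [integral_add ((integrable_potential hα μ _).const_mul _)
    ((integrable_of_continuous (continuous_Lambda_rpow_right hα x) _).const_mul _),
    integral_const_mul, integral_const_mul, Lambda_self, Real.zero_rpow hα.ne']
  change (1 - t) * ((1 - t) * _ + t * potential α μ x) + _ = _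
  ring

/-- First variation towards δ_x: compare with (1 - t)μ + tδ_x, divide by t and let t tend to 0. -/
theorem potential_le_of_isMax {α : ℝ} (hα : 0 < α) {μ : ProbabilityMeasure (Sph d)}
    (hμ : ∀ ν : ProbabilityMeasure (Sph d), doubleEnergy α ν ≤ doubleEnergy α μ) (x : Sph d) :
    potential α μ x ≤ doubleEnergy α μ := by
  by_contra! h
  set U := potential α μ x
  set I := doubleEnergy α μ
  have key : ∀ t : ℝ, 0 < t → t < 1 → 2 * (1 - t) * U ≤ (2 - t) * I := by
    intro t h0 h1
    have := hμ (mixDirac μ x h0.le h1.le)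
    rw [doubleEnergy_mixDirac hα] at this
    have h2 : t * (2 * (1 - t) * U) ≤ t * ((2 - t) * I) := by
      change (1 - t) ^ 2 * I + 2 * t * (1 - t) * U ≤ I at this
      nlinarith
    exact le_of_mul_le_mul_left h2 h0
  have h3 : Tendsto (fun t : ℝ => (2 - t) * I - 2 * (1 - t) * U) (𝓝[>] 0)
      (𝓝 ((2 - 0) * I - 2 * (1 - 0) * U)) :=
    (Continuous.tendsto (by fun_prop) 0).mono_left nhdsWithin_le_nhds
  have h4 := ge_of_tendsto h3 (b := 0) (by
    filter_upwards [Ioo_mem_nhdsGT one_pos] with t ht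
    linarith [key t ht.1 ht.2])
  linarith

/-- The potential is everywhere at most the energy, and its μ-mean is the energy. -/
theorem ae_potential_eq_of_isMax {α : ℝ} (hα : 0 < α) {μ : ProbabilityMeasure (Sph d)}
    (hμ : ∀ ν : ProbabilityMeasure (Sph d), doubleEnergy α ν ≤ doubleEnergy α μ) :
    ∀ᵐ x ∂(μ : Measure (Sph d)), potential α μ x = doubleEnergy α μ := by
  have h := integral_eq_zero_iff_of_nonneg (μ := (μ : Measure (Sph d)))
    (f := fun x => doubleEnergy α μ - potential α μ x)
    (fun x => sub_nonneg.2 (potential_le_of_isMax hα hμ x))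
    ((integrable_const _).sub (integrable_potential hα μ _))
  rw [integral_sub (integrable_const _) (integrable_potential hα μ _)] at h
  have h2 := h.1 (by simp [doubleEnergy])
  filter_upwards [h2] with x hx
  simp only [Pi.zero_apply] at hx
  linarith

theorem exists_isMax_doubleEnergy {α : ℝ} (hα : 0 < α) :
    ∃ μ : ProbabilityMeasure (Sph d), ∀ ν : ProbabilityMeasure (Sph d), doubleEnergy α ν ≤ doubleEnergy α μ := by
  obtain ⟨ν, -⟩ := ponEq_nonempty d
  obtain ⟨μ, -, hμ⟩ := isCompact_univ.exists_isMaxOn ⟨ν, mem_univ ν⟩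
    (continuous_doubleEnergy (d := d) hα).continuousOn
  exact ⟨μ, fun ν => hμ (mem_univ ν)⟩

/-! ### Second moments and the exponent 2 -/

theorem inner_eq_sum (x y : Sph d) :
    ⟪(x : Euc d), (y : Euc d)⟫ = ∑ i, (x : Euc d) i * (y : Euc d) i := by
  simp [PiLp.inner_apply, mul_comm]

/-- The double integral is the squared Frobenius norm of the second-moment matrix A, which has trace
1; Cauchy–Schwarz on the diagonal finishes. -/
theorem inv_le_integral_inner_sq (μ : ProbabilityMeasure (Sph d)) :
    ((d : ℝ) + 1)⁻¹ ≤ ∫ x, ∫ y, ⟪(x : Euc d), (y : Euc d)⟫ ^ 2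
      ∂(μ : Measure (Sph d)) ∂(μ : Measure (Sph d)) := by
  set A : Fin (d + 1) → Fin (d + 1) → ℝ := fun i j =>
    ∫ x : Sph d, (x : Euc d) i * (x : Euc d) j ∂(μ : Measure (Sph d)) with hA
  have hI : ∀ (i j : Fin (d + 1)),
      Integrable (fun x : Sph d => (x : Euc d) i * (x : Euc d) j) (μ : Measure (Sph d)) :=
    fun i j => integrable_of_continuous (by fun_prop) _
  have h1 : ∀ x : Sph d, ∫ y : Sph d, ⟪(x : Euc d), (y : Euc d)⟫ ^ 2 ∂(μ : Measure (Sph d)) =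
      ∑ i, ∑ j, ((x : Euc d) i * (x : Euc d) j) * A i j := by
    intro x
    have : ∀ y : Sph d, ⟪(x : Euc d), (y : Euc d)⟫ ^ 2 =
        ∑ i, ∑ j, ((x : Euc d) i * (x : Euc d) j) * ((y : Euc d) i * (y : Euc d) j) := by
      intro y
      rw [inner_eq_sum, sq, Finset.sum_mul_sum]
      exact Finset.sum_congr rfl fun i _ => Finset.sum_congr rfl fun j _ => by ring
    simp only [this]
    rw [integral_finsetSum _ fun i _ => integrable_finsetSum _ fun j _ => (hI i j).const_mul _]
    refine Finset.sum_congr rfl fun i _ => ?_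
    rw [integral_finsetSum _ fun j _ => (hI i j).const_mul _]
    simp only [integral_const_mul, hA]
  simp only [h1]
  rw [integral_finsetSum _ fun i _ => integrable_finsetSum _ fun j _ => (hI i j).mul_const _]
  have h2 : ∀ i, ∫ x : Sph d, ∑ j, ((x : Euc d) i * (x : Euc d) j) * A i j
      ∂(μ : Measure (Sph d)) = ∑ j, A i j ^ 2 := by
    intro i
    rw [integral_finsetSum _ fun j _ => (hI i j).mul_const _]
    simp only [integral_mul_const, hA, sq]
  simp only [h2]
  have h3 : ∑ i, A i i = 1 := by
    simp only [hA]
    rw [← integral_finsetSum _ fun i _ => hI i i]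
    have : ∀ x : Sph d, ∑ i, (x : Euc d) i * (x : Euc d) i = 1 := by
      intro x
      rw [← inner_eq_sum]; simp
    simp [this]
  have h4 : ∑ i, A i i ^ 2 ≤ ∑ i, ∑ j, A i j ^ 2 :=
    Finset.sum_le_sum fun i _ => Finset.single_le_sum (f := fun j => A i j ^ 2)
      (fun j _ => sq_nonneg _) (Finset.mem_univ i)
  have h5 := sq_sum_le_card_mul_sum_sq (s := Finset.univ) (f := fun i => A i i)
  rw [h3, Finset.card_univ, Fintype.card_fin] at h5
  push_cast at h5
  refine le_trans ?_ h4
  rw [inv_le_iff_one_le_mul₀' (by positivity)]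
  linarith

theorem doubleEnergy_two_le (μ : ProbabilityMeasure (Sph d)) :
    doubleEnergy 2 μ ≤ (d : ℝ) / (d + 1) := by
  have hc : Continuous fun p : Sph d × Sph d => ⟪(p.1 : Euc d), (p.2 : Euc d)⟫ ^ 2 := by fun_prop
  have hi := integrable_of_continuous hc ((μ : Measure (Sph d)).prod μ)
  rw [doubleEnergy_eq_integral_prod two_pos]
  have h1 : ∫ p : Sph d × Sph d, Lambda p.1 p.2 ^ (2 : ℝ) ∂((μ : Measure (Sph d)).prod μ) ≤
      ∫ p : Sph d × Sph d, (1 - ⟪(p.1 : Euc d), (p.2 : Euc d)⟫ ^ 2)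
        ∂((μ : Measure (Sph d)).prod μ) :=
    integral_mono (integrable_of_continuous (continuous_Lambda_rpow two_pos) _)
      ((integrable_const _).sub hi) fun p => by simpa using Lambda_sq_le p.1 p.2
  rw [integral_sub (integrable_const _) hi, integral_prod _ hi] at h1
  have h2 := inv_le_integral_inner_sq μ
  have h3 : (d : ℝ) / (d + 1) = 1 - ((d : ℝ) + 1)⁻¹ := by field_simp; ring
  simp only [integral_const, probReal_univ, smul_eq_mul, mul_one] at h1
  linarith

/-! ### Equidistributions and bounds on the threshold -/

/-- The measures which give mass `1 / (d + 1)` to each line of an orthogonal frame. -/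
def IsEquidistributed (μ : ProbabilityMeasure (Sph d)) : Prop :=
  ∃ b : OrthonormalBasis (Fin (d + 1)) ℝ (Euc d), ∀ i,
    (μ : Measure (Sph d)) {basisPoint b i, -basisPoint b i} = ((d : ℝ≥0∞) + 1)⁻¹

theorem inner_basisPoint_self (b : OrthonormalBasis (Fin (d + 1)) ℝ (Euc d)) (i : Fin (d + 1)) :
    ⟪(basisPoint b i : Euc d), (basisPoint b i : Euc d)⟫ = 1 := by
  simp [basisPoint]

theorem inner_basisPoint_of_ne (b : OrthonormalBasis (Fin (d + 1)) ℝ (Euc d)) {i j : Fin (d + 1)}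
    (h : i ≠ j) : ⟪(basisPoint b i : Euc d), (basisPoint b j : Euc d)⟫ = 0 :=
  b.inner_eq_zero h

theorem basisPoint_ne_neg (b : OrthonormalBasis (Fin (d + 1)) ℝ (Euc d)) (i j : Fin (d + 1)) :
    basisPoint b j ≠ -basisPoint b i := by
  intro h
  have h1 := inner_basisPoint_self b j
  have h2 : (basisPoint b j : Euc d) = -(basisPoint b i : Euc d) := congrArg Subtype.val h
  rcases eq_or_ne j i with rfl | hj
  · nth_rewrite 2 [h2] at h1
    rw [inner_neg_right, inner_basisPoint_self] at h1
    norm_num at h1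
  · nth_rewrite 2 [h2] at h1
    rw [inner_neg_right, inner_basisPoint_of_ne b hj] at h1
    norm_num at h1

theorem disjoint_lines (b : OrthonormalBasis (Fin (d + 1)) ℝ (Euc d)) :
    Pairwise (Function.onFun Disjoint
      fun i => ({basisPoint b i, -basisPoint b i} : Set (Sph d))) := by
  have key : ∀ (i j : Fin (d + 1)) (x : Sph d), x ∈ ({basisPoint b i, -basisPoint b i} : Set (Sph d)) →
      x ∈ ({basisPoint b j, -basisPoint b j} : Set (Sph d)) → i = j := by
    intro i j x hi hj
    by_contra hne
    have h := inner_basisPoint_of_ne b hne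
    have hx : ⟪(x : Euc d), (x : Euc d)⟫ = 1 := by simp
    have hi' : (x : Euc d) = basisPoint b i ∨ (x : Euc d) = -(basisPoint b i : Euc d) :=
      hi.imp (congrArg Subtype.val) (congrArg Subtype.val)
    have hj' : (x : Euc d) = basisPoint b j ∨ (x : Euc d) = -(basisPoint b j : Euc d) :=
      hj.imp (congrArg Subtype.val) (congrArg Subtype.val)
    have h0 : ⟪(x : Euc d), (x : Euc d)⟫ = 0 := by
      rcases hi' with hi' | hi' <;> rcases hj' with hj' | hj' <;> nth_rewrite 1 [hi'] <;> rw [hj'] <;>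
        simp [h]
    rw [hx] at h0
    exact one_ne_zero h0
  exact fun i j hij => Set.disjoint_left.2 fun x hi hj => hij (key i j x hi hj)

theorem measure_iUnion_lines {μ : Measure (Sph d)}
    {b : OrthonormalBasis (Fin (d + 1)) ℝ (Euc d)}
    (h : ∀ i, μ {basisPoint b i, -basisPoint b i} = ((d : ℝ≥0∞) + 1)⁻¹) :
    μ (⋃ i, {basisPoint b i, -basisPoint b i}) = 1 := by
  rw [measure_iUnion (disjoint_lines b) fun i => (Set.toFinite _).measurableSet, tsum_fintype]
  simp only [h, Finset.sum_const, Finset.card_univ, Fintype.card_fin, nsmul_eq_mul]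
  push_cast
  exact ENNReal.mul_inv_cancel (by simp) (by simp)

theorem integral_eq_sum_of_even {μ : ProbabilityMeasure (Sph d)}
    {b : OrthonormalBasis (Fin (d + 1)) ℝ (Euc d)}
    (h : ∀ i, (μ : Measure (Sph d)) {basisPoint b i, -basisPoint b i} = ((d : ℝ≥0∞) + 1)⁻¹)
    {f : Sph d → ℝ} (hf : Continuous f) (he : ∀ x, f (-x) = f x) :
    ∫ x, f x ∂(μ : Measure (Sph d)) = ((d : ℝ) + 1)⁻¹ * ∑ i, f (basisPoint b i) := by
  have hfi := integrable_of_continuous hf (μ : Measure (Sph d))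
  have hm : ∀ i, MeasurableSet ({basisPoint b i, -basisPoint b i} : Set (Sph d)) :=
    fun i => (Set.toFinite _).measurableSet
  have h1 : (μ : Measure (Sph d)).restrict (⋃ i, {basisPoint b i, -basisPoint b i}) = μ := by
    refine Measure.restrict_eq_self_of_ae_mem ?_
    exact (mem_ae_iff_prob_eq_one (MeasurableSet.iUnion hm)).2 (measure_iUnion_lines h)
  nth_rewrite 1 [← h1]
  rw [integral_iUnion_fintype hm (disjoint_lines b) fun i => hfi.integrableOn, Finset.mul_sum]
  refine Finset.sum_congr rfl fun i _ => ?_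
  rw [setIntegral_congr_fun (g := fun _ => f (basisPoint b i)) (hm i), setIntegral_const,
    measureReal_def, h i]
  · simp [ENNReal.toReal_inv, ENNReal.toReal_add]
  · rintro x (rfl | hx)
    · rfl
    · rw [mem_singleton_iff] at hx
      simp [hx, he]

theorem potential_of_lines {μ : ProbabilityMeasure (Sph d)}
    {b : OrthonormalBasis (Fin (d + 1)) ℝ (Euc d)}
    (h : ∀ i, (μ : Measure (Sph d)) {basisPoint b i, -basisPoint b i} = ((d : ℝ≥0∞) + 1)⁻¹)
    {α : ℝ} (hα : 0 < α) (x : Sph d) :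
    potential α μ x = ((d : ℝ) + 1)⁻¹ * ∑ i, Lambda x (basisPoint b i) ^ α :=
  integral_eq_sum_of_even h (continuous_Lambda_rpow_right hα x)
    fun y => by rw [Lambda_neg_right]

theorem IsEquidistributed.doubleEnergy_eq {μ : ProbabilityMeasure (Sph d)}
    (h : IsEquidistributed μ) {α : ℝ} (hα : 0 < α) : doubleEnergy α μ = d / (d + 1) := by
  obtain ⟨b, h⟩ := h
  unfold doubleEnergy
  rw [integral_eq_sum_of_even h (continuous_potential_right hα μ) fun x => by
    simp only [potential, Lambda_neg_left]]
  have h1 : ∀ j, potential α μ (basisPoint b j) = ((d : ℝ) + 1)⁻¹ * d := by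
    intro j
    rw [potential_of_lines h hα]
    congr 1
    rw [Finset.sum_eq_add_sum_sdiff_singleton_of_mem (Finset.mem_univ j), Lambda_self, Real.zero_rpow hα.ne',
      zero_add, Finset.sum_congr rfl (g := fun _ => (1 : ℝ))]
    · simp [Finset.card_sdiff]
    · intro i hi
      have hne : j ≠ i := by
        rintro rfl; simp at hi
      rw [Lambda_eq_one_of_inner_eq_zero (inner_basisPoint_of_ne b hne), Real.one_rpow]
  simp only [h1, Finset.sum_const, Finset.card_univ, Fintype.card_fin, nsmul_eq_mul]
  push_cast
  field_simp

theorem isEquidistributed_of_mem_PDeltaEq {μ : ProbabilityMeasure (Sph d)} (h : μ ∈ PDeltaEq d) :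
    IsEquidistributed μ := by
  obtain ⟨ν, ⟨⟨b, hb⟩, hν⟩, M, -, hM⟩ := h
  have hrange : ∀ x : Sph d, x ∈ (ν : Measure (Sph d)).support ↔ ∃ i, x = basisPoint b i := by
    intro x
    constructor
    · intro hx
      obtain ⟨i, hi⟩ : (x : Euc d) ∈ range b := hb ▸ mem_image_of_mem _ hx
      exact ⟨i, Subtype.ext hi.symm⟩
    · rintro ⟨i, rfl⟩
      have : (b i : Euc d) ∈ range b := ⟨i, rfl⟩
      rw [← hb] at this
      obtain ⟨y, hy, hyi⟩ := this
      rwa [show basisPoint b i = y from Subtype.ext hyi.symm]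
  have hpair : ∀ i, (ν : Measure (Sph d)) {basisPoint b i, -basisPoint b i} =
      ((d : ℝ≥0∞) + 1)⁻¹ := by
    intro i
    rw [Set.insert_eq, measure_union (by simpa using basisPoint_ne_neg b i i)
      (measurableSet_singleton _), hν _ ((hrange _).2 ⟨i, rfl⟩)]
    have h0 : (ν : Measure (Sph d)) {-basisPoint b i} = 0 := by
      refine measure_mono_null ?_ (ν : Measure (Sph d)).measure_compl_support
      rw [singleton_subset_iff, mem_compl_iff, hrange]
      rintro ⟨j, hj⟩
      exact basisPoint_ne_neg b i j hj.symm
    rw [h0, add_zero]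
  refine ⟨b.map M.symm, fun i => ?_⟩
  set p := basisPoint (b.map M.symm) i with hp
  have hMp : rotate M p = basisPoint b i := Subtype.ext (by simp [rotate, hp, basisPoint])
  have hneg : ∀ x, rotate M (-x) = -rotate M x := fun x => Subtype.ext (by simp [rotate])
  have hinj : Function.Injective (rotate M : Sph d → Sph d) := fun x y hxy =>
    Subtype.ext (M.injective (congrArg Subtype.val hxy))
  have hsurj : Function.Surjective (rotate M : Sph d → Sph d) := fun y =>
    ⟨rotate M.symm y, Subtype.ext (by simp [rotate])⟩
  have hfin : ({p, -p} : Set (Sph d)).Finite := Set.toFinite _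
  -- `EssEquiv` compares open symmetric sets only, so the closed pair {p, -p} is measured through
  -- its complement.
  have hsym : ({p, -p} : Set (Sph d))ᶜ ∪ -({p, -p} : Set (Sph d))ᶜ = {p, -p}ᶜ := by
    refine union_eq_left.2 fun x hx => ?_
    simp only [Set.mem_neg, mem_compl_iff, mem_insert_iff, mem_singleton_iff, neg_inj] at hx ⊢
    rw [neg_eq_iff_eq_neg] at hx
    tauto
  have h1 := hM _ hfin.isClosed.isOpen_compl
  rw [hsym, image_compl_eq ⟨hinj, hsurj⟩, image_pair, hneg, hMp] at h1
  have h2 := prob_add_prob_compl (μ := (μ : Measure (Sph d))) hfin.measurableSet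
  have h3 := prob_add_prob_compl (μ := (ν : Measure (Sph d)))
    (s := {basisPoint b i, -basisPoint b i}) (Set.toFinite _).measurableSet
  rw [← h3, h1] at h2
  rw [← hpair i]
  exact (ENNReal.add_left_inj (measure_ne_top _ _)).1 h2

/-- Otherwise an equidistribution would maximize at α, putting α in the set whose infimum is the
threshold. -/
theorem exists_lt_doubleEnergy_of_lt_thresholdExponent {α : ℝ} (hα : 0 < α)
    (h : ENNReal.ofReal α < thresholdExponent d) :
    ∃ μ : ProbabilityMeasure (Sph d), (d : ℝ) / (d + 1) < doubleEnergy α μ := by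
  by_contra! hn
  obtain ⟨ν, hν⟩ := pDeltaEq_nonempty d
  refine (sInf_le ?_ : thresholdExponent d ≤ ENNReal.ofReal α).not_gt h
  refine ⟨by simpa using hα, ENNReal.ofReal_lt_top, ν, hν, ?_⟩
  rw [mem_argmaxEnergy_iff ENNReal.ofReal_ne_top, ENNReal.toReal_ofReal hα.le,
    (isEquidistributed_of_mem_PDeltaEq hν).doubleEnergy_eq hα]
  exact hn

theorem thresholdExponent_le_two : thresholdExponent d ≤ 2 := by
  by_contra! h
  obtain ⟨μ, hμ⟩ := exists_lt_doubleEnergy_of_lt_thresholdExponent (α := 2) two_pos (by simpa using h)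
  exact hμ.not_ge (doubleEnergy_two_le μ)

theorem doubleEnergy_le_of_thresholdExponent_lt {α : ℝ}
    (h : thresholdExponent d < ENNReal.ofReal α) (μ : ProbabilityMeasure (Sph d)) :
    doubleEnergy α μ ≤ d / (d + 1) := by
  obtain ⟨β, ⟨h0, ht, ν, hν, hmax⟩, hβ⟩ := sInf_lt_iff.1 h
  rw [mem_argmaxEnergy_iff ht.ne] at hmax
  have hpos := ENNReal.toReal_pos h0.ne' ht.ne
  rw [← (isEquidistributed_of_mem_PDeltaEq hν).doubleEnergy_eq hpos]
  refine (doubleEnergy_anti hpos ?_ μ).trans (hmax μ)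
  exact ((ENNReal.lt_ofReal_iff_toReal_lt ht.ne).1 hβ).le

/-- For α < 1 the potential at the midpoint of two frame vectors is (d - 1 + 2·2^(-α))/(d + 1) >
d/(d + 1), against the Euler–Lagrange inequality. -/
theorem one_le_thresholdExponent (hd : 1 ≤ d) : 1 ≤ thresholdExponent d := by
  refine le_sInf ?_
  rintro α ⟨h0, ht, μ, hμ, hmax⟩
  by_contra! hlt
  have hpos := ENNReal.toReal_pos h0.ne' ht.ne
  have hlt1 : α.toReal < 1 := by
    rw [← ENNReal.toReal_one]
    exact (ENNReal.toReal_lt_toReal ht.ne ENNReal.one_ne_top).2 hlt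
  rw [mem_argmaxEnergy_iff ht.ne] at hmax
  have hE := (isEquidistributed_of_mem_PDeltaEq hμ).doubleEnergy_eq hpos
  obtain ⟨b, hb⟩ := isEquidistributed_of_mem_PDeltaEq hμ
  obtain ⟨n, rfl⟩ : ∃ n, d = n + 1 := ⟨d - 1, by omega⟩
  have h01 : (0 : Fin (n + 1 + 1)) ≠ 1 := by simp
  have hnorm : ‖b 0 + b 1‖ = √2 := by
    rw [← Real.sqrt_sq (norm_nonneg (b 0 + b 1)), norm_add_sq_real, b.inner_eq_zero h01]
    norm_num
  let x : Sph (n + 1) := ⟨(√2)⁻¹ • (b 0 + b 1), by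
    rw [mem_sphere_zero_iff_norm, norm_smul, hnorm, norm_inv,
      Real.norm_of_nonneg (Real.sqrt_nonneg 2), inv_mul_cancel₀ (by positivity)]⟩
  have hx : ∀ i, ⟪(x : Euc (n + 1)), (basisPoint b i : Euc (n + 1))⟫ =
      (√2)⁻¹ * (⟪b 0, b i⟫ + ⟪b 1, b i⟫) := by
    intro i
    rw [← inner_add_left, ← real_inner_smul_left]; rfl
  have hhalf : ∀ i, ⟪(x : Euc (n + 1)), (basisPoint b i : Euc (n + 1))⟫ = (√2)⁻¹ →
      Lambda x (basisPoint b i) = 1 / 2 := by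
    intro i hi
    have : (√2)⁻¹ = Real.cos (Real.pi / 4) := by
      rw [Real.cos_pi_div_four]; field_simp; norm_num
    rw [Lambda_eq, hi, abs_of_nonneg (by positivity), this,
      Real.arccos_cos (by positivity) (by linarith [Real.pi_pos])]
    have := Real.pi_ne_zero
    field_simp; norm_num
  have h0' := hhalf 0 (by rw [hx, b.inner_eq_zero h01.symm]; simp)
  have h1' := hhalf 1 (by rw [hx, b.inner_eq_zero h01]; simp)
  have h2' : ∀ i : Fin n, Lambda x (basisPoint b i.succ.succ) = 1 := by
    intro i
    apply Lambda_eq_one_of_inner_eq_zero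
    rw [hx, b.inner_eq_zero (Fin.succ_ne_zero _).symm, b.inner_eq_zero, add_zero, mul_zero]
    rw [← Fin.succ_zero_eq_one]
    exact fun h => (Fin.succ_ne_zero i).symm (Fin.succ_injective _ h)
  have hU := potential_le_of_isMax hpos hmax x
  rw [potential_of_lines hb hpos, hE, Fin.sum_univ_succ, Fin.sum_univ_succ, Fin.succ_zero_eq_one,
    h0', h1'] at hU
  simp only [h2', Real.one_rpow, Finset.sum_const, Finset.card_univ, Fintype.card_fin,
    nsmul_eq_mul, mul_one] at hU
  have hgt : (1 / 2 : ℝ) < (1 / 2) ^ α.toReal := by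
    simpa using Real.rpow_lt_rpow_of_exponent_gt (x := 1 / 2) (by norm_num) (by norm_num) hlt1
  push_cast at hU
  rw [inv_mul_le_iff₀ (by positivity), mul_div_cancel₀ _ (by positivity)] at hU
  linarith

/-! ### Geometry near an orthogonal frame -/

theorem exists_sign_norm_sub_le (x p : Sph d) :
    ∃ x' : Sph d, (x' = x ∨ x' = -x) ∧ ‖(x' : Euc d) - p‖ ≤ 2 * Lambda x p := by
  rcases le_total 0 ⟪(x : Euc d), (p : Euc d)⟫ with h | h
  · exact ⟨x, Or.inl rfl, norm_sub_le_Lambda h⟩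
  · refine ⟨-x, Or.inr rfl, ?_⟩
    rw [← Lambda_neg_left]
    exact norm_sub_le_Lambda (by simpa using h)

theorem Lambda_of_sign {x x' : Sph d} (h : x' = x ∨ x' = -x) (y : Sph d) :
    Lambda x' y = Lambda x y := by
  rcases h with rfl | rfl
  · rfl
  · exact Lambda_neg_left _ _

theorem abs_inner_of_sign {x x' : Sph d} (h : x' = x ∨ x' = -x) (y : Sph d) :
    |⟪(x' : Euc d), (y : Euc d)⟫| = |⟪(x : Euc d), (y : Euc d)⟫| := by
  rcases h with rfl | rfl <;> simp

theorem Lambda_le_of_near {x y p : Sph d} {r : ℝ} (hx : Lambda x p ≤ r) (hy : Lambda y p ≤ r) :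
    Lambda x y ≤ 4 * r := by
  obtain ⟨x', hx', h1⟩ := exists_sign_norm_sub_le x p
  obtain ⟨y', hy', h2⟩ := exists_sign_norm_sub_le y p
  rw [← Lambda_of_sign hx', Lambda_comm, ← Lambda_of_sign hy', Lambda_comm]
  have := Lambda_le_norm_sub x' y'
  have h3 := norm_sub_le_norm_sub_add_norm_sub (x' : Euc d) p y'
  rw [norm_sub_rev (p : Euc d)] at h3
  linarith

theorem eq_of_Lambda_lt (b : OrthonormalBasis (Fin (d + 1)) ℝ (Euc d)) {r : ℝ} (hr : r < 1 / 4)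
    {x : Sph d} {i j : Fin (d + 1)} (hi : Lambda x (basisPoint b i) < r)
    (hj : Lambda x (basisPoint b j) < r) : i = j := by
  by_contra hne
  have h0 := Lambda_le_of_near (x := basisPoint b i) (y := basisPoint b j) (p := x) (r := r)
    (by rw [Lambda_comm]; exact hi.le) (by rw [Lambda_comm]; exact hj.le)
  rw [Lambda_eq_one_of_inner_eq_zero (inner_basisPoint_of_ne b hne)] at h0
  linarith

/-- Near-orthogonality to points y j close to the other b j nearly determines x. The vector v = x -
x' is orthogonal to x + x', so b i may be replaced by its difference from (x + x')/2, giving a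
component at most δ‖v‖. For j ≠ i, replacing b j by y j costs at most δ‖v‖. The total error (d +
1)δ‖v‖ ≤ ‖v‖/2 is absorbed. -/
theorem norm_sub_le_sum_abs_inner (b : OrthonormalBasis (Fin (d + 1)) ℝ (Euc d)) {δ : ℝ}
    (hδ : (d + 1) * δ ≤ 1 / 2) {i : Fin (d + 1)} {x x' : Sph d} {y : Fin (d + 1) → Sph d}
    (hx : ‖(x : Euc d) - b i‖ ≤ δ) (hx' : ‖(x' : Euc d) - b i‖ ≤ δ)
    (hy : ∀ j ≠ i, ‖(y j : Euc d) - b j‖ ≤ δ) :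
    ‖(x : Euc d) - x'‖ ≤ 2 * ∑ j ∈ Finset.univ.erase i,
      (|⟪(x : Euc d), (y j : Euc d)⟫| + |⟪(x' : Euc d), (y j : Euc d)⟫|) := by
  set v : Euc d := (x : Euc d) - x' with hv
  have h1 : ‖v‖ ≤ ∑ k, |⟪v, b k⟫| := by
    conv_lhs => rw [← b.sum_repr' v]
    refine (norm_sum_le _ _).trans (Finset.sum_le_sum fun k _ => ?_)
    rw [norm_smul, real_inner_comm]
    simp
  have hi : |⟪v, b i⟫| ≤ δ * ‖v‖ := by
    have h2 : ⟪v, (x : Euc d) + x'⟫ = 0 := by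
      rw [hv, inner_sub_left, inner_add_right, inner_add_right, real_inner_comm (x : Euc d) x']
      simp
      ring
    have h3 : ⟪v, b i⟫ = -⟪v, (1 / 2 : ℝ) • (((x : Euc d) - b i) + ((x' : Euc d) - b i))⟫ := by
      have : ((x : Euc d) - b i) + ((x' : Euc d) - b i) = (x : Euc d) + x' - (2 : ℝ) • b i := by
        rw [two_smul]; abel
      rw [this, inner_smul_right, inner_sub_right, h2, inner_smul_right]
      ring
    rw [h3, abs_neg]
    refine (abs_real_inner_le_norm _ _).trans ?_
    rw [mul_comm]
    gcongr
    rw [norm_smul]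
    have := norm_add_le ((x : Euc d) - b i) ((x' : Euc d) - b i)
    norm_num
    linarith
  have hj : ∀ j ∈ Finset.univ.erase i, |⟪v, b j⟫| ≤
      (|⟪(x : Euc d), (y j : Euc d)⟫| + |⟪(x' : Euc d), (y j : Euc d)⟫|) + δ * ‖v‖ := by
    intro j hj
    have h2 : ⟪v, b j⟫ = ⟪(x : Euc d), (y j : Euc d)⟫ - ⟪(x' : Euc d), (y j : Euc d)⟫ -
        ⟪v, (y j : Euc d) - b j⟫ := by
      rw [inner_sub_right, hv, inner_sub_left, inner_sub_left]; ring
    have h3 := abs_real_inner_le_norm v ((y j : Euc d) - b j)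
    have h4 := mul_le_mul_of_nonneg_left (hy j (Finset.ne_of_mem_erase hj)) (norm_nonneg v)
    rw [h2]
    refine (abs_sub _ _).trans ?_
    have := abs_sub ⟪(x : Euc d), (y j : Euc d)⟫ ⟪(x' : Euc d), (y j : Euc d)⟫
    linarith
  rw [← Finset.add_sum_erase _ _ (Finset.mem_univ i)] at h1
  have h5 := Finset.sum_le_sum hj
  rw [Finset.sum_add_distrib, Finset.sum_const, Finset.card_erase_of_mem (Finset.mem_univ i),
    Finset.card_univ, Fintype.card_fin, nsmul_eq_mul, Nat.add_sub_cancel] at h5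
  nlinarith [norm_nonneg v]

theorem Lambda_le_sum_abs_inner (b : OrthonormalBasis (Fin (d + 1)) ℝ (Euc d)) {r : ℝ}
    (hr : (d + 1) * r ≤ 1 / 4) {i : Fin (d + 1)} {x x' : Sph d} {y : Fin (d + 1) → Sph d}
    (hx : Lambda x (basisPoint b i) ≤ r) (hx' : Lambda x' (basisPoint b i) ≤ r)
    (hy : ∀ j ≠ i, Lambda (y j) (basisPoint b j) ≤ r) :
    Lambda x x' ≤ 2 * ∑ j ∈ Finset.univ.erase i,
      (|⟪(x : Euc d), (y j : Euc d)⟫| + |⟪(x' : Euc d), (y j : Euc d)⟫|) := by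
  obtain ⟨z, hz, h1⟩ := exists_sign_norm_sub_le x (basisPoint b i)
  obtain ⟨z', hz', h2⟩ := exists_sign_norm_sub_le x' (basisPoint b i)
  choose w hw h3 using fun j => exists_sign_norm_sub_le (y j) (basisPoint b j)
  have h4 := norm_sub_le_sum_abs_inner b (δ := 2 * r) (by linarith) (x := z) (x' := z') (y := w)
    (h1.trans (by linarith)) (h2.trans (by linarith)) fun j hj =>
      (h3 j).trans (by linarith [hy j hj])
  rw [← Lambda_of_sign hz, Lambda_comm, ← Lambda_of_sign hz', Lambda_comm]
  refine (Lambda_le_norm_sub z z').trans (h4.trans_eq ?_)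
  congr 1
  refine Finset.sum_congr rfl fun j _ => ?_
  have h5 : ∀ u : Sph d, |⟪(u : Euc d), (w j : Euc d)⟫| = |⟪(u : Euc d), (y j : Euc d)⟫| :=
    fun u => by rw [real_inner_comm, abs_inner_of_sign (hw j), real_inner_comm]
  rw [abs_inner_of_sign hz, abs_inner_of_sign hz', h5, h5]

/-! ### Strict local maximality for exponents above 1 -/

theorem continuous_Lambda_left (p : Sph d) : Continuous fun x => Lambda x p := by
  simp only [Lambda_eq]
  fun_prop

/-- The points within `r` of the line through `b i`. -/
def lineNhd (b : OrthonormalBasis (Fin (d + 1)) ℝ (Euc d)) (r : ℝ) (i : Fin (d + 1)) :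
    Set (Sph d) :=
  {x | Lambda x (basisPoint b i) < r}

theorem isOpen_lineNhd (b : OrthonormalBasis (Fin (d + 1)) ℝ (Euc d)) (r : ℝ) (i : Fin (d + 1)) :
    IsOpen (lineNhd b r i) :=
  isOpen_lt (continuous_Lambda_left (basisPoint b i)) continuous_const

theorem measurableSet_lineNhd (b : OrthonormalBasis (Fin (d + 1)) ℝ (Euc d)) (r : ℝ)
    (i : Fin (d + 1)) : MeasurableSet (lineNhd b r i) :=
  (isOpen_lineNhd b r i).measurableSet

theorem disjoint_lineNhd (b : OrthonormalBasis (Fin (d + 1)) ℝ (Euc d)) {r : ℝ} (hr : r < 1 / 4) :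
    Pairwise (Function.onFun Disjoint (lineNhd b r)) :=
  fun _ _ hij => Set.disjoint_left.2 fun _ hi hj => hij (eq_of_Lambda_lt b hr hi hj)

theorem sum_measureReal_eq_one {X ι : Type*} [MeasurableSpace X] [Fintype ι] {A : ι → Set X}
    (hA : ∀ i, MeasurableSet (A i)) (hd : Pairwise (Function.onFun Disjoint A))
    (μ : Measure X) [IsProbabilityMeasure μ] (hμ : ∀ᵐ x ∂μ, x ∈ ⋃ i, A i) :
    ∑ i, μ.real (A i) = 1 := by
  have h := integral_iUnion_fintype (μ := μ) (f := fun _ => (1 : ℝ)) hA hd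
    fun i => (integrable_const _).integrableOn
  rw [Measure.restrict_eq_self_of_ae_mem hμ] at h
  simpa using h.symm

theorem integral_prod_eq_sum {X ι : Type*} [MeasurableSpace X] [Fintype ι] {A : ι → Set X}
    (hA : ∀ i, MeasurableSet (A i)) (hd : Pairwise (Function.onFun Disjoint A))
    (μ : Measure X) [IsProbabilityMeasure μ] (hμ : ∀ᵐ x ∂μ, x ∈ ⋃ i, A i) {f : X × X → ℝ}
    (hf : Integrable f (μ.prod μ)) :
    ∫ p, f p ∂(μ.prod μ) = ∑ i, ∑ j, ∫ p in A i ×ˢ A j, f p ∂(μ.prod μ) := by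
  rw [← Fintype.sum_prod_type' (f := fun i j => ∫ p in A i ×ˢ A j, f p ∂(μ.prod μ)),
    ← integral_iUnion_fintype (s := fun q : ι × ι => A q.1 ×ˢ A q.2)
    (fun q => (hA _).prod (hA _)) _ fun q => hf.integrableOn]
  · rw [Measure.restrict_eq_self_of_ae_mem]
    have h1 : ∀ᵐ p ∂(μ.prod μ), p.1 ∈ ⋃ i, A i := Measure.quasiMeasurePreserving_fst.ae hμ
    have h2 : ∀ᵐ p ∂(μ.prod μ), p.2 ∈ ⋃ i, A i := Measure.quasiMeasurePreserving_snd.ae hμ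
    filter_upwards [h1, h2] with p hp1 hp2
    obtain ⟨i, hi⟩ := mem_iUnion.1 hp1
    obtain ⟨j, hj⟩ := mem_iUnion.1 hp2
    exact mem_iUnion.2 ⟨(i, j), hi, hj⟩
  · rintro ⟨i, j⟩ ⟨i', j'⟩ hne
    refine Set.disjoint_left.2 fun p hp hp' => hne ?_
    have h1 : i = i' := by
      by_contra h
      exact Set.disjoint_left.1 (hd h) hp.1 hp'.1
    have h2 : j = j' := by
      by_contra h
      exact Set.disjoint_left.1 (hd h) hp.2 hp'.2
    rw [h1, h2]

theorem continuous_abs_inner :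
    Continuous fun p : Sph d × Sph d => |⟪(p.1 : Euc d), (p.2 : Euc d)⟫| := by fun_prop

/-- The integral of `|x ⬝ y|` over `A × B`. -/
noncomputable def crossIntegral (μ : ProbabilityMeasure (Sph d)) (A B : Set (Sph d)) : ℝ :=
  ∫ p in A ×ˢ B, |⟪(p.1 : Euc d), (p.2 : Euc d)⟫| ∂((μ : Measure (Sph d)).prod μ)

theorem crossIntegral_nonneg (μ : ProbabilityMeasure (Sph d)) (A B : Set (Sph d)) :
    0 ≤ crossIntegral μ A B := integral_nonneg fun _ => abs_nonneg _

theorem setIntegral_Lambda_rpow_le_cross {α : ℝ} (hα : 1 ≤ α) (μ : ProbabilityMeasure (Sph d))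
    (A B : Set (Sph d)) :
    ∫ p in A ×ˢ B, Lambda p.1 p.2 ^ α ∂((μ : Measure (Sph d)).prod μ) ≤
      (μ : Measure (Sph d)).real A * (μ : Measure (Sph d)).real B - 1 / 2 * crossIntegral μ A B := by
  have hi := (integrable_of_continuous (continuous_abs_inner (d := d))
    ((μ : Measure (Sph d)).prod μ)).integrableOn (s := A ×ˢ B)
  have h : ∫ p in A ×ˢ B, (1 - 1 / 2 * |⟪(p.1 : Euc d), (p.2 : Euc d)⟫|)
      ∂((μ : Measure (Sph d)).prod μ) =
      (μ : Measure (Sph d)).real A * (μ : Measure (Sph d)).real B - 1 / 2 * crossIntegral μ A B := by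
    rw [integral_sub (integrable_const _) (hi.const_mul _), integral_const_mul, crossIntegral]
    simp [measureReal_prod_prod]
  rw [← h]
  refine integral_mono (integrable_of_continuous (continuous_Lambda_rpow (by linarith)) _)
    ((integrable_const _).sub (hi.const_mul _)) fun p => ?_
  refine (Lambda_rpow_anti one_pos hα _ _).trans ?_
  rw [Real.rpow_one]
  exact Lambda_le_one_sub _ _

/-- Two points of one cluster have Λ ≤ 4r, so Λ^α = Λ^(α-1) Λ gains a factor that vanishes with r
precisely because α > 1. -/
theorem setIntegral_Lambda_rpow_le_diag {α r : ℝ} (hα : 1 < α)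
    (b : OrthonormalBasis (Fin (d + 1)) ℝ (Euc d)) (i : Fin (d + 1))
    (μ : ProbabilityMeasure (Sph d)) :
    ∫ p in lineNhd b r i ×ˢ lineNhd b r i, Lambda p.1 p.2 ^ α ∂((μ : Measure (Sph d)).prod μ) ≤
      (4 * r) ^ (α - 1) * ∫ p in lineNhd b r i ×ˢ lineNhd b r i, Lambda p.1 p.2
        ∂((μ : Measure (Sph d)).prod μ) := by
  rw [← integral_const_mul]
  have hm := measurableSet_lineNhd b r i
  refine setIntegral_mono_on
    (integrable_of_continuous (continuous_Lambda_rpow (by linarith)) _).integrableOn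
    (((integrable_of_continuous continuous_Lambda _).const_mul _).integrableOn) (hm.prod hm)
    fun p hp => ?_
  have h4 := Lambda_le_of_near (le_of_lt hp.1) (le_of_lt hp.2)
  have h0 := Lambda_nonneg p.1 p.2
  calc Lambda p.1 p.2 ^ α = Lambda p.1 p.2 ^ (α - 1) * Lambda p.1 p.2 := by
        rw [← Real.rpow_add_one' h0 (by linarith)]; ring_nf
    _ ≤ _ := by
        gcongr

/-- Averaging over cluster j yields a point y j whose integral of |y j ⬝ x| over cluster i is at
most 1/m times the cross integral. Integrating `Lambda_le_sum_abs_inner` with these points bounds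
the spread by the defect of orthogonality. -/
theorem setIntegral_Lambda_le_of_mass {r m : ℝ} (hr : (d + 1) * r ≤ 1 / 4) (hm : 0 < m)
    (b : OrthonormalBasis (Fin (d + 1)) ℝ (Euc d)) {μ : ProbabilityMeasure (Sph d)}
    (hμ : ∀ i, m ≤ (μ : Measure (Sph d)).real (lineNhd b r i)) (i : Fin (d + 1)) :
    ∫ p in lineNhd b r i ×ˢ lineNhd b r i, Lambda p.1 p.2 ∂((μ : Measure (Sph d)).prod μ) ≤
      4 / m * ∑ j ∈ Finset.univ.erase i, crossIntegral μ (lineNhd b r j) (lineNhd b r i) := by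
  set A := lineNhd b r i with hA
  have hmA : MeasurableSet A := measurableSet_lineNhd b r i
  let g : Sph d → ℝ := fun y => ∫ x in A, |⟪(y : Euc d), (x : Euc d)⟫| ∂(μ : Measure (Sph d))
  have hg0 : ∀ y, 0 ≤ g y := fun y => integral_nonneg fun _ => abs_nonneg _
  have hgi : Integrable g μ := (integrable_of_continuous (continuous_abs_inner (d := d))
    ((μ : Measure (Sph d)).prod ((μ : Measure (Sph d)).restrict A))).integral_prod_left
  have hex : ∀ j, ∃ y ∈ lineNhd b r j, g y ≤ 1 / m * crossIntegral μ (lineNhd b r j) A := by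
    intro j
    have hpos : 0 < (μ : Measure (Sph d)).real (lineNhd b r j) := hm.trans_le (hμ j)
    obtain ⟨y, hy, h⟩ := exists_le_setAverage
      (ENNReal.toReal_pos_iff.1 hpos).1.ne' (measure_ne_top _ _) hgi.integrableOn
    refine ⟨y, hy, h.trans ?_⟩
    rw [setAverage_eq, smul_eq_mul, crossIntegral,
      setIntegral_prod _ (integrable_of_continuous continuous_abs_inner _).integrableOn]
    have h2 : 0 ≤ ∫ y in lineNhd b r j, g y ∂(μ : Measure (Sph d)) := integral_nonneg hg0
    refine mul_le_mul_of_nonneg_right ?_ h2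
    rw [one_div]
    exact inv_anti₀ hm (hμ j)
  choose y hy hgy using hex
  have hf1 : ∀ j, Continuous fun p : Sph d × Sph d => |⟪(p.1 : Euc d), (y j : Euc d)⟫| :=
    fun j => by fun_prop
  have hf2 : ∀ j, Continuous fun p : Sph d × Sph d => |⟪(p.2 : Euc d), (y j : Euc d)⟫| :=
    fun j => by fun_prop
  have hf12 : ∀ j, Integrable (fun p : Sph d × Sph d => |⟪(p.1 : Euc d), (y j : Euc d)⟫| +
      |⟪(p.2 : Euc d), (y j : Euc d)⟫|)
      (((μ : Measure (Sph d)).restrict A).prod ((μ : Measure (Sph d)).restrict A)) :=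
    fun j => integrable_of_continuous ((hf1 j).add (hf2 j)) _
  have hgy' : ∀ j, ∫ x in A, |⟪(x : Euc d), (y j : Euc d)⟫| ∂(μ : Measure (Sph d)) = g (y j) :=
    fun j => by simp only [g, real_inner_comm]
  set ν := (μ : Measure (Sph d)).restrict A with hν
  have hνu : ν.real univ ≤ 1 := by
    rw [hν, measureReal_restrict_apply_univ]; exact measureReal_le_one
  calc ∫ p in A ×ˢ A, Lambda p.1 p.2 ∂((μ : Measure (Sph d)).prod μ)
      ≤ ∫ p in A ×ˢ A, 2 * ∑ j ∈ Finset.univ.erase i,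
          (|⟪(p.1 : Euc d), (y j : Euc d)⟫| + |⟪(p.2 : Euc d), (y j : Euc d)⟫|)
          ∂((μ : Measure (Sph d)).prod μ) := by
        refine setIntegral_mono_on (integrable_of_continuous continuous_Lambda _).integrableOn
          (integrable_of_continuous (by fun_prop) _).integrableOn (hmA.prod hmA) fun p hp => ?_
        exact Lambda_le_sum_abs_inner b hr (le_of_lt hp.1) (le_of_lt hp.2) fun j _ => (hy j).le
    _ = 2 * ∑ j ∈ Finset.univ.erase i, (ν.real univ * g (y j) + ν.real univ * g (y j)) := by
        rw [← Measure.prod_restrict, integral_const_mul, integral_finsetSum _ fun j _ => hf12 j]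
        congr 1
        refine Finset.sum_congr rfl fun j _ => ?_
        rw [integral_add (integrable_of_continuous (hf1 j) _) (integrable_of_continuous (hf2 j) _),
          integral_fun_fst (fun x : Sph d => |⟪(x : Euc d), (y j : Euc d)⟫|),
          integral_fun_snd (fun x : Sph d => |⟪(x : Euc d), (y j : Euc d)⟫|), hgy']
        rfl
    _ ≤ 2 * ∑ j ∈ Finset.univ.erase i, 2 * (1 / m * crossIntegral μ (lineNhd b r j) A) := by
        gcongr with j _
        nlinarith [hgy j, hg0 (y j)]
    _ = _ := by
        rw [← Finset.mul_sum, ← Finset.mul_sum]; ring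

/-- Split the double integral into blocks of clusters; since the masses sum to 1, the products over
distinct clusters sum to 1 - ∑ m_i². -/
theorem doubleEnergy_le_of_near {α r : ℝ} (hα : 1 < α) (hr : r < 1 / 4)
    (b : OrthonormalBasis (Fin (d + 1)) ℝ (Euc d)) {μ : ProbabilityMeasure (Sph d)}
    (hμ : ∀ᵐ x ∂(μ : Measure (Sph d)), x ∈ ⋃ i, lineNhd b r i) :
    doubleEnergy α μ ≤ 1 - ∑ i, (μ : Measure (Sph d)).real (lineNhd b r i) ^ 2
      - 1 / 2 * ∑ i, ∑ j ∈ Finset.univ.erase i, crossIntegral μ (lineNhd b r i) (lineNhd b r j)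
      + (4 * r) ^ (α - 1) * ∑ i, ∫ p in lineNhd b r i ×ˢ lineNhd b r i, Lambda p.1 p.2
          ∂((μ : Measure (Sph d)).prod μ) := by
  have hA := measurableSet_lineNhd b r
  have hD := disjoint_lineNhd b hr
  have hsum := sum_measureReal_eq_one hA hD (μ : Measure (Sph d)) hμ
  rw [doubleEnergy_eq_integral_prod (by linarith), integral_prod_eq_sum hA hD _ hμ
    (integrable_of_continuous (continuous_Lambda_rpow (by linarith)) _)]
  have h1 : ∀ i, ∑ j, ∫ p in lineNhd b r i ×ˢ lineNhd b r j, Lambda p.1 p.2 ^ α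
      ∂((μ : Measure (Sph d)).prod μ) ≤
      (4 * r) ^ (α - 1) * (∫ p in lineNhd b r i ×ˢ lineNhd b r i, Lambda p.1 p.2
          ∂((μ : Measure (Sph d)).prod μ)) +
        ((μ : Measure (Sph d)).real (lineNhd b r i) -
          (μ : Measure (Sph d)).real (lineNhd b r i) ^ 2 -
          1 / 2 * ∑ j ∈ Finset.univ.erase i,
            crossIntegral μ (lineNhd b r i) (lineNhd b r j)) := by
    intro i
    rw [← Finset.add_sum_erase _ _ (Finset.mem_univ i)]
    refine add_le_add (setIntegral_Lambda_rpow_le_diag hα b i μ) ?_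
    refine (Finset.sum_le_sum fun j _ => setIntegral_Lambda_rpow_le_cross hα.le μ _ _).trans_eq ?_
    rw [← Finset.add_sum_erase _ _ (Finset.mem_univ i)] at hsum
    rw [Finset.sum_sub_distrib, ← Finset.mul_sum, ← Finset.mul_sum, eq_sub_of_add_eq' hsum]
    ring
  refine (Finset.sum_le_sum fun i _ => h1 i).trans_eq ?_
  rw [Finset.sum_add_distrib, Finset.sum_sub_distrib, Finset.sum_sub_distrib, hsum,
    ← Finset.mul_sum, ← Finset.mul_sum]
  ring

theorem sum_sq_eq_inv_add {n : ℕ} {m : Fin (n + 1) → ℝ} (h : ∑ i, m i = 1) :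
    ∑ i, m i ^ 2 = ((n : ℝ) + 1)⁻¹ + ∑ i, (m i - ((n : ℝ) + 1)⁻¹) ^ 2 := by
  have : ∀ i, (m i - ((n : ℝ) + 1)⁻¹) ^ 2 =
      m i ^ 2 - 2 * ((n : ℝ) + 1)⁻¹ * m i + ((n : ℝ) + 1)⁻¹ ^ 2 := fun i => by ring
  simp only [this, Finset.sum_add_distrib, Finset.sum_sub_distrib, ← Finset.mul_sum, h]
  simp only [Finset.sum_const, Finset.card_univ, Fintype.card_fin, nsmul_eq_mul]
  push_cast
  field_simp
  ring

theorem ae_Lambda_eq_zero {μ : ProbabilityMeasure (Sph d)} {A : Set (Sph d)}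
    (hA : (μ : Measure (Sph d)) A ≠ 0) (hm : MeasurableSet A)
    (h : ∫ p in A ×ˢ A, Lambda p.1 p.2 ∂((μ : Measure (Sph d)).prod μ) = 0) :
    ∃ f ∈ A, ∀ᵐ x ∂(μ : Measure (Sph d)).restrict A, Lambda f x = 0 := by
  rw [← Measure.prod_restrict, integral_eq_zero_iff_of_nonneg (fun p => Lambda_nonneg _ _)
    (integrable_of_continuous continuous_Lambda _)] at h
  have h1 := Measure.ae_ae_of_ae_prod h
  have : (ae ((μ : Measure (Sph d)).restrict A)).NeBot := by
    rwa [ae_neBot, Ne, Measure.restrict_eq_zero]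
  obtain ⟨f, hf, hfA⟩ := (h1.and (ae_restrict_mem hm)).exists
  exact ⟨f, hfA, hf⟩

theorem inner_eq_zero_of_crossIntegral {μ : ProbabilityMeasure (Sph d)} {A B : Set (Sph d)}
    (hA : (μ : Measure (Sph d)) A ≠ 0) (hB : (μ : Measure (Sph d)) B ≠ 0)
    (h : crossIntegral μ A B = 0) {f g : Sph d}
    (hf : ∀ᵐ x ∂(μ : Measure (Sph d)).restrict A, Lambda f x = 0)
    (hg : ∀ᵐ x ∂(μ : Measure (Sph d)).restrict B, Lambda g x = 0) :
    ⟪(f : Euc d), (g : Euc d)⟫ = 0 := by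
  rw [crossIntegral, ← Measure.prod_restrict, integral_eq_zero_iff_of_nonneg (fun p => abs_nonneg _)
    (integrable_of_continuous continuous_abs_inner _)] at h
  have h1 := Measure.ae_ae_of_ae_prod h
  have : (ae ((μ : Measure (Sph d)).restrict A)).NeBot := by
    rwa [ae_neBot, Ne, Measure.restrict_eq_zero]
  have : (ae ((μ : Measure (Sph d)).restrict B)).NeBot := by
    rwa [ae_neBot, Ne, Measure.restrict_eq_zero]
  obtain ⟨x, hx, hfx⟩ := (h1.and hf).exists
  obtain ⟨y, hy, hgy⟩ := (hx.and hg).exists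
  have h2 := eq_or_eq_neg_of_Lambda_eq_zero hfx
  have h3 := eq_or_eq_neg_of_Lambda_eq_zero hgy
  have hy' : |⟪(x : Euc d), (y : Euc d)⟫| = 0 := hy
  rw [← abs_eq_zero, abs_inner_of_sign h2, real_inner_comm, abs_inner_of_sign h3, real_inner_comm]
  exact hy'

/-- A vanishing diagonal integral concentrates a cluster on one line; vanishing cross integrals make
these lines orthogonal. -/
theorem isEquidistributed_of_integrals_eq_zero {A : Fin (d + 1) → Set (Sph d)}
    {μ : ProbabilityMeasure (Sph d)} (hA : ∀ i, MeasurableSet (A i))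
    (hneg : ∀ i, ∀ x ∈ A i, -x ∈ A i)
    (hm : ∀ i, (μ : Measure (Sph d)).real (A i) = ((d : ℝ) + 1)⁻¹)
    (hL : ∀ i, ∫ p in A i ×ˢ A i, Lambda p.1 p.2 ∂((μ : Measure (Sph d)).prod μ) = 0)
    (hJ : ∀ i j, i ≠ j → crossIntegral μ (A i) (A j) = 0) : IsEquidistributed μ := by
  have h0 : ∀ i, (μ : Measure (Sph d)) (A i) ≠ 0 := by
    intro i hi
    have := hm i
    rw [measureReal_def, hi, ENNReal.toReal_zero, eq_comm, inv_eq_zero] at this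
    exact (by positivity : (d : ℝ) + 1 ≠ 0) this
  choose f hfA hf using fun i => ae_Lambda_eq_zero (h0 i) (hA i) (hL i)
  have hon : Orthonormal ℝ fun i => (f i : Euc d) :=
    ⟨fun i => by simp, fun i j hij =>
      inner_eq_zero_of_crossIntegral (h0 i) (h0 j) (hJ i j hij) (hf i) (hf j)⟩
  obtain ⟨b, hb⟩ := Orthonormal.exists_orthonormalBasis_extension_of_card_eq
    (𝕜 := ℝ) (E := Euc d) (ι := Fin (d + 1)) (by simp) (v := fun i => (f i : Euc d)) (s := univ)
    (hon.comp _ Subtype.val_injective)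
  refine ⟨b, fun i => ?_⟩
  have hbi : basisPoint b i = f i := Subtype.ext (hb i (mem_univ i))
  have h1 : (μ : Measure (Sph d)) {f i, -f i} = (μ : Measure (Sph d)) (A i) := by
    refine le_antisymm (measure_mono ?_) (measure_mono_ae ?_)
    · rintro x (rfl | hx)
      · exact hfA i
      · rw [mem_singleton_iff.1 hx]; exact hneg i _ (hfA i)
    · filter_upwards [(ae_restrict_iff' (hA i)).1 (hf i)] with x hx hxA
      rw [Lambda_comm] at hx
      rcases eq_or_eq_neg_of_Lambda_eq_zero (hx hxA) with h | h
      · exact Or.inl h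
      · exact Or.inr h
  rw [hbi, h1, ← ENNReal.ofReal_toReal (measure_ne_top (μ : Measure (Sph d)) (A i))]
  have := hm i
  rw [measureReal_def] at this
  rw [this, ENNReal.ofReal_inv_of_pos (by positivity), ENNReal.ofReal_add (by positivity) one_pos.le]
  simp

theorem exists_radius {α : ℝ} (hα : 1 < α) {η ρ : ℝ} (hη : 0 < η) (hρ : 0 < ρ) :
    ∃ r : ℝ, 0 < r ∧ r < ρ ∧ (4 * r) ^ (α - 1) < η := by
  have h : Tendsto (fun r : ℝ => (4 * r) ^ (α - 1)) (𝓝[>] 0) (𝓝 ((4 * 0) ^ (α - 1))) :=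
    ((Continuous.rpow_const (by fun_prop) fun _ => Or.inr (by linarith)).tendsto 0).mono_left
      nhdsWithin_le_nhds
  rw [mul_zero, Real.zero_rpow (by linarith)] at h
  obtain ⟨r, h1, h2⟩ := ((h.eventually (gt_mem_nhds hη)).and (Ioo_mem_nhdsGT hρ)).exists
  exact ⟨r, h2.1, h2.2, h1⟩

/-- For `α > 1` the equidistributions over orthogonal frames are strict local maximizers: a
measure carried by small neighbourhoods of the lines of an orthogonal frame has no larger energy,
and equal energy only if it is itself such an equidistribution. -/
theorem exists_radius_local_maximality {α : ℝ} (hα : 1 < α) :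
    ∃ r : ℝ, 0 < r ∧ ∀ (b : OrthonormalBasis (Fin (d + 1)) ℝ (Euc d))
      (μ : ProbabilityMeasure (Sph d)),
      (∀ᵐ x ∂(μ : Measure (Sph d)), x ∈ ⋃ i, lineNhd b r i) →
      doubleEnergy α μ ≤ d / (d + 1) ∧
        ((d : ℝ) / (d + 1) ≤ doubleEnergy α μ → IsEquidistributed μ) := by
  set N : ℝ := (d : ℝ) + 1 with hN
  have hN1 : 1 ≤ N := by rw [hN]; linarith [(Nat.cast_nonneg d : (0 : ℝ) ≤ d)]
  have hN0 : 0 < N := by linarith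
  -- The bound on ε = (4r)^(α-1) gives 8Nε ≤ 1/4 for the balanced case and ε < (2N)⁻² for the other;
  -- r < 1/(4N) keeps the clusters disjoint and the absorption above valid.
  obtain ⟨r, hr0, hrρ, hrη⟩ := exists_radius hα (η := (32 * N ^ 2)⁻¹) (ρ := (4 * N)⁻¹)
    (by positivity) (by positivity)
  have hNr : N * r ≤ 1 / 4 := by
    have := mul_le_mul_of_nonneg_left hrρ.le hN0.le
    rw [mul_inv] at this
    field_simp at this
    linarith
  have hr4 : r < 1 / 4 := by
    refine hrρ.trans_le ?_
    rw [one_div]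
    exact inv_anti₀ (by norm_num) (by linarith)
  refine ⟨r, hr0, fun b μ hμ => ?_⟩
  have hE := doubleEnergy_le_of_near hα hr4 b hμ
  have hsum := sum_measureReal_eq_one (measurableSet_lineNhd b r) (disjoint_lineNhd b hr4) _ hμ
  have hsq := sum_sq_eq_inv_add hsum
  set m : Fin (d + 1) → ℝ := fun i => (μ : Measure (Sph d)).real (lineNhd b r i) with hm
  set L : Fin (d + 1) → ℝ := fun i => ∫ p in lineNhd b r i ×ˢ lineNhd b r i, Lambda p.1 p.2
    ∂((μ : Measure (Sph d)).prod μ) with hL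
  set J := ∑ i, ∑ j ∈ Finset.univ.erase i, crossIntegral μ (lineNhd b r i) (lineNhd b r j) with hJ
  set ε := (4 * r) ^ (α - 1) with hε
  change doubleEnergy α μ ≤ 1 - ∑ i, m i ^ 2 - 1 / 2 * J + ε * ∑ i, L i at hE
  change ∑ i, m i ^ 2 = N⁻¹ + ∑ i, (m i - N⁻¹) ^ 2 at hsq
  change ∑ i, m i = 1 at hsum
  have hε0 : 0 ≤ ε := by positivity
  have hJ0 : 0 ≤ J := Finset.sum_nonneg fun i _ => Finset.sum_nonneg fun j _ =>
    crossIntegral_nonneg _ _ _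
  have hc : (d : ℝ) / N = 1 - N⁻¹ := by
    rw [hN]; field_simp; ring
  have hL0 : ∀ i, 0 ≤ L i := fun i => integral_nonneg fun p => Lambda_nonneg _ _
  rw [hc]
  -- If every cluster has at least half its ideal mass, the spread gain is at most J/4, less than
  -- the loss J/2 unless J = 0. Otherwise the variance of the masses alone outweighs ε.
  by_cases hmass : ∀ i, (2 * N)⁻¹ ≤ m i
  · have hLJ : ∑ i, L i ≤ 8 * N * J := by
      have h1 := Finset.sum_le_sum fun i (_ : i ∈ Finset.univ) =>
        setIntegral_Lambda_le_of_mass hNr (by positivity : 0 < (2 * N)⁻¹) b hmass i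
      refine h1.trans_eq ?_
      rw [← Finset.mul_sum, hJ, Finset.sum_comm' (t' := Finset.univ)
        (s' := fun j => Finset.univ.erase j) (by simp [eq_comm])]
      congr 1
      field_simp; norm_num
    have hεJ : ε * ∑ i, L i ≤ 1 / 4 * J := by
      have h2 : ε * (8 * N) ≤ 1 / 4 := by
        have h3 := mul_le_mul_of_nonneg_right hrη.le (by positivity : 0 ≤ 8 * N)
        refine h3.trans ?_
        rw [inv_mul_le_iff₀ (by positivity)]
        nlinarith
      calc _ ≤ ε * (8 * N * J) := by gcongr
        _ = (ε * (8 * N)) * J := by ring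
        _ ≤ _ := by gcongr
    have hv : 0 ≤ ∑ i, (m i - N⁻¹) ^ 2 := Finset.sum_nonneg fun i _ => sq_nonneg _
    refine ⟨by linarith, fun hge => ?_⟩
    have hJz : J = 0 := by linarith
    have hvz : ∑ i, (m i - N⁻¹) ^ 2 = 0 := by linarith
    have hLz : ∑ i, L i = 0 := by
      refine le_antisymm ?_ (Finset.sum_nonneg fun i _ => hL0 i)
      simpa [hJz] using hLJ
    refine isEquidistributed_of_integrals_eq_zero (measurableSet_lineNhd b r)
      (fun i x hx => ?_) (fun i => ?_) (fun i => ?_) fun i j hij => ?_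
    · rw [lineNhd, mem_ofPred_eq, Lambda_neg_left]; exact hx
    · have := (Finset.sum_eq_zero_iff_of_nonneg fun i _ => sq_nonneg _).1 hvz i (Finset.mem_univ i)
      exact sub_eq_zero.1 (pow_eq_zero_iff two_ne_zero |>.1 this)
    · exact (Finset.sum_eq_zero_iff_of_nonneg fun i _ => hL0 i).1 hLz i (Finset.mem_univ i)
    · have h1 := (Finset.sum_eq_zero_iff_of_nonneg fun i _ => Finset.sum_nonneg fun j _ =>
        crossIntegral_nonneg _ _ _).1 hJz i (Finset.mem_univ i)
      exact (Finset.sum_eq_zero_iff_of_nonneg fun j _ => crossIntegral_nonneg _ _ _).1 h1 j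
        (Finset.mem_erase.2 ⟨hij.symm, Finset.mem_univ j⟩)
  · push Not at hmass
    obtain ⟨k, hk⟩ := hmass
    have hk' : (2 * N)⁻¹ ^ 2 ≤ (m k - N⁻¹) ^ 2 := by
      have h1 : N⁻¹ = 2 * (2 * N)⁻¹ := by field_simp
      have h2 : 0 < (2 * N)⁻¹ := by positivity
      nlinarith
    have hv : (2 * N)⁻¹ ^ 2 ≤ ∑ i, (m i - N⁻¹) ^ 2 :=
      hk'.trans (Finset.single_le_sum (f := fun i => (m i - N⁻¹) ^ 2)
        (fun i _ => sq_nonneg _) (Finset.mem_univ k))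
    have hLm : ∀ i ∈ Finset.univ, L i ≤ m i := by
      intro i _
      have h1 : L i ≤ ∫ p in lineNhd b r i ×ˢ lineNhd b r i, (1 : ℝ)
          ∂((μ : Measure (Sph d)).prod μ) :=
        integral_mono (integrable_of_continuous continuous_Lambda _) (integrable_const _)
          fun p => Lambda_le_one _ _
      simp only [integral_const, measureReal_restrict_apply_univ, measureReal_prod_prod,
        smul_eq_mul, mul_one] at h1
      exact h1.trans (mul_le_of_le_one_right measureReal_nonneg measureReal_le_one)
    have hLs := Finset.sum_le_sum hLm
    rw [hsum] at hLs
    have hεL : ε * ∑ i, L i ≤ ε := mul_le_of_le_one_right hε0 hLs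
    have hlt : (32 * N ^ 2)⁻¹ < (2 * N)⁻¹ ^ 2 := by
      rw [inv_pow]
      exact inv_strictAnti₀ (by positivity) (by nlinarith)
    exact ⟨by linarith, fun hge => absurd hge (by push Not; linarith)⟩

/-! ### Projective space and d_∞-closeness -/

theorem toRP_eq_iff {x y : Sph d} : toRP x = toRP y ↔ x = y ∨ x = -y :=
  Quotient.eq (r := antipodal d)

theorem isOpenQuotientMap_toRP : IsOpenQuotientMap (toRP : Sph d → RP d) where
  surjective := Quotient.mk_surjective
  continuous := continuous_toRP
  isOpenMap := by
    intro U hU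
    have hq : IsQuotientMap (toRP : Sph d → RP d) := isQuotientMap_quotient_mk'
    rw [← hq.isOpen_preimage]
    have : toRP ⁻¹' (toRP '' U) = U ∪ -U := by
      ext x
      simp only [mem_preimage, mem_image, toRP_eq_iff, mem_union, Set.mem_neg]
      constructor
      · rintro ⟨y, hy, rfl | rfl⟩
        · exact Or.inl hy
        · right; exact hy
      · rintro (h | h)
        · exact ⟨x, h, Or.inl rfl⟩
        · exact ⟨-x, h, Or.inr rfl⟩
    rw [this]
    exact hU.union (hU.preimage continuous_neg)

instance : SecondCountableTopology (RP d) :=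
  isOpenQuotientMap_toRP.isQuotientMap.secondCountableTopology isOpenQuotientMap_toRP.isOpenMap

instance : T2Space (RP d) := by
  rw [t2Space_iff_of_isOpenQuotientMap isOpenQuotientMap_toRP]
  simp only [toRP_eq_iff]
  exact (isClosed_eq continuous_fst continuous_snd).union
    (isClosed_eq continuous_fst continuous_snd.neg)

theorem rhoRP_toRP (x y : Sph d) : rhoRP (toRP x) (toRP y) = Real.pi / 2 * Lambda x y := by
  change min (rho x y) (Real.pi - rho x y) = _
  have := Real.pi_ne_zero
  rw [Lambda, Lambda0]
  field_simp

theorem rhoRP_nonneg (p q : RP d) : 0 ≤ rhoRP p q := by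
  obtain ⟨x, rfl⟩ := isOpenQuotientMap_toRP.surjective p
  obtain ⟨y, rfl⟩ := isOpenQuotientMap_toRP.surjective q
  rw [rhoRP_toRP]
  exact mul_nonneg (by positivity) (Lambda_nonneg x y)

theorem rhoRP_le (p q : RP d) : rhoRP p q ≤ Real.pi / 2 := by
  obtain ⟨x, rfl⟩ := isOpenQuotientMap_toRP.surjective p
  obtain ⟨y, rfl⟩ := isOpenQuotientMap_toRP.surjective q
  rw [rhoRP_toRP]
  exact mul_le_of_le_one_right (by positivity) (Lambda_le_one x y)

theorem rhoRP_self (p : RP d) : rhoRP p p = 0 := by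
  obtain ⟨x, rfl⟩ := isOpenQuotientMap_toRP.surjective p
  rw [rhoRP_toRP, Lambda_self, mul_zero]

theorem rhoRP_comm (p q : RP d) : rhoRP p q = rhoRP q p := by
  obtain ⟨x, rfl⟩ := isOpenQuotientMap_toRP.surjective p
  obtain ⟨y, rfl⟩ := isOpenQuotientMap_toRP.surjective q
  rw [rhoRP_toRP, rhoRP_toRP, Lambda_comm]

theorem continuous_rhoRP_left (q : RP d) : Continuous fun p => rhoRP p q := by
  obtain ⟨y, rfl⟩ := isOpenQuotientMap_toRP.surjective q
  rw [← isOpenQuotientMap_toRP.continuous_comp_iff]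
  simp only [Function.comp_def, rhoRP_toRP]
  exact (continuous_Lambda_left y).const_mul _

theorem dInfty_self_lt (μ : ProbabilityMeasure (RP d)) {r : ℝ} (hr : 0 < r) :
    dInfty μ μ < r := by
  refine lt_of_le_of_lt ?_ hr
  have hm : Measurable fun p : RP d => (p, p) := measurable_id.prodMk measurable_id
  set γ : ProbabilityMeasure (RP d × RP d) := μ.map hm.aemeasurable with hγ
  have hγμ : (γ : Measure (RP d × RP d)) = (μ : Measure (RP d)).map fun p => (p, p) := rfl
  have hcoup : γ ∈ couplings μ μ := by
    constructor
    · rw [hγμ, Measure.map_map measurable_fst hm]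
      exact Measure.map_id
    · rw [hγμ, Measure.map_map measurable_snd hm]
      exact Measure.map_id
  refine (csInf_le ⟨0, ?_⟩ (mem_image_of_mem _ hcoup)).trans ?_
  · rintro _ ⟨γ', -, rfl⟩
    refine Real.sSup_nonneg ?_
    rintro _ ⟨p, -, rfl⟩
    exact rhoRP_nonneg _ _
  · refine Real.sSup_nonpos ?_
    rintro _ ⟨p, hp, rfl⟩
    have hdiag : p ∈ diagonal (RP d) := by
      refine Measure.support_subset_of_isClosed isClosed_diagonal ?_ hp
      rw [hγμ]
      exact (ae_map_iff hm.aemeasurable isClosed_diagonal.measurableSet).2 (.of_forall fun _ => rfl)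
    change rhoRP p.1 p.2 ≤ 0
    rw [mem_diagonal_iff.1 hdiag, rhoRP_self]

theorem exists_coupling_of_dInfty_lt {μ ν : ProbabilityMeasure (RP d)} {r : ℝ}
    (h : dInfty μ ν < r) :
    ∃ γ ∈ couplings μ ν, ∀ᵐ p ∂(γ : Measure (RP d × RP d)), rhoRP p.1 p.2 < r := by
  have hne : (couplings μ ν).Nonempty := by
    refine ⟨μ.prod ν, ?_, ?_⟩
    · rw [ProbabilityMeasure.toMeasure_prod, Measure.map_fst_prod]; simp
    · rw [ProbabilityMeasure.toMeasure_prod, Measure.map_snd_prod]; simp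
  obtain ⟨_, ⟨γ, hγ, rfl⟩, hlt⟩ := exists_lt_of_csInf_lt (hne.image _) h
  refine ⟨γ, hγ, ?_⟩
  filter_upwards [(γ : Measure (RP d × RP d)).support_mem_ae] with p hp
  refine lt_of_le_of_lt (le_csSup ⟨Real.pi / 2, ?_⟩
    (mem_image_of_mem (fun q : RP d × RP d => rhoRP q.1 q.2) hp)) hlt
  rintro _ ⟨q, -, rfl⟩
  exact rhoRP_le _ _

theorem swap_mem_couplings {μ ν : ProbabilityMeasure (RP d)}
    {γ : ProbabilityMeasure (RP d × RP d)} (h : γ ∈ couplings μ ν) :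
    γ.map measurable_swap.aemeasurable ∈ couplings ν μ := by
  constructor
  · change ((γ : Measure (RP d × RP d)).map Prod.swap).map Prod.fst = _
    rw [Measure.map_map measurable_fst measurable_swap]
    exact h.2
  · change ((γ : Measure (RP d × RP d)).map Prod.swap).map Prod.snd = _
    rw [Measure.map_map measurable_snd measurable_swap]
    exact h.1

theorem measurableSet_rhoRP_lt (r : ℝ) :
    MeasurableSet {p : RP d × RP d | rhoRP p.1 p.2 < r} := by
  have : Continuous fun p : RP d × RP d => rhoRP p.1 p.2 := by
    rw [← (isOpenQuotientMap_toRP.prodMap isOpenQuotientMap_toRP).continuous_comp_iff]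
    simp only [Function.comp_def, Prod.map_fst, Prod.map_snd, rhoRP_toRP]
    exact continuous_Lambda.const_mul _
  exact (isOpen_lt this continuous_const).measurableSet

theorem ae_mem_lineNhd_of_coupling {μ ν : ProbabilityMeasure (Sph d)}
    {b : OrthonormalBasis (Fin (d + 1)) ℝ (Euc d)}
    (hν : ∀ i, (ν : Measure (Sph d)) {basisPoint b i, -basisPoint b i} = ((d : ℝ≥0∞) + 1)⁻¹)
    {γ : ProbabilityMeasure (RP d × RP d)} (hγ : γ ∈ couplings (projMeasure μ) (projMeasure ν))
    {r : ℝ} (h : ∀ᵐ p ∂(γ : Measure (RP d × RP d)), rhoRP p.1 p.2 < r) :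
    ∀ᵐ x ∂(μ : Measure (Sph d)), x ∈ ⋃ i, lineNhd b r i := by
  have h1 : ∀ᵐ q ∂(projMeasure ν : Measure (RP d)), q ∈ range fun i => toRP (basisPoint b i) := by
    have hmap : (projMeasure ν : Measure (RP d)) = (ν : Measure (Sph d)).map toRP := rfl
    rw [hmap]
    refine (ae_map_iff continuous_toRP.measurable.aemeasurable
      (finite_range _).measurableSet).2 ?_
    filter_upwards [(mem_ae_iff_prob_eq_one (MeasurableSet.iUnion fun i =>
      (Set.toFinite _).measurableSet)).2 (measure_iUnion_lines hν)] with x hx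
    obtain ⟨i, hi⟩ := mem_iUnion.1 hx
    exact ⟨i, (toRP_eq_iff.2 hi).symm⟩
  rw [← hγ.2] at h1
  have h2 := ae_of_ae_map measurable_snd.aemeasurable h1
  have h3 : ∀ᵐ q ∂(γ : Measure (RP d × RP d)).map Prod.fst,
      q ∈ ⋃ i, {q | rhoRP q (toRP (basisPoint b i)) < r} := by
    refine (ae_map_iff measurable_fst.aemeasurable (MeasurableSet.iUnion fun i =>
      (isOpen_lt (continuous_rhoRP_left _) continuous_const).measurableSet)).2 ?_
    filter_upwards [h, h2] with p hp hp2
    obtain ⟨i, hi⟩ := hp2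
    refine mem_iUnion.2 ⟨i, ?_⟩
    simp only [mem_ofPred_eq]
    rwa [show toRP (basisPoint b i) = p.2 from hi]
  rw [hγ.1] at h3
  have h4 := ae_of_ae_map (μ := (μ : Measure (Sph d))) continuous_toRP.measurable.aemeasurable h3
  filter_upwards [h4] with x hx
  obtain ⟨i, hi⟩ := mem_iUnion.1 hx
  simp only [mem_ofPred_eq, rhoRP_toRP] at hi
  refine mem_iUnion.2 ⟨i, lt_of_le_of_lt ?_ hi⟩
  -- The projective distance is (π/2)Λ, hence at least Λ.
  exact le_mul_of_one_le_left (Lambda_nonneg _ _) (by linarith [Real.pi_gt_three])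

theorem ae_mem_lineNhd_of_dInfty_lt {μ ν : ProbabilityMeasure (Sph d)}
    {b : OrthonormalBasis (Fin (d + 1)) ℝ (Euc d)}
    (hν : ∀ i, (ν : Measure (Sph d)) {basisPoint b i, -basisPoint b i} = ((d : ℝ≥0∞) + 1)⁻¹)
    {r : ℝ} (h : dInfty (projMeasure μ) (projMeasure ν) < r) :
    ∀ᵐ x ∂(μ : Measure (Sph d)), x ∈ ⋃ i, lineNhd b r i := by
  obtain ⟨γ, hγ, h⟩ := exists_coupling_of_dInfty_lt h
  exact ae_mem_lineNhd_of_coupling hν hγ h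

theorem ae_mem_lineNhd_of_dInfty_lt' {μ ν : ProbabilityMeasure (Sph d)}
    {b : OrthonormalBasis (Fin (d + 1)) ℝ (Euc d)}
    (hν : ∀ i, (ν : Measure (Sph d)) {basisPoint b i, -basisPoint b i} = ((d : ℝ≥0∞) + 1)⁻¹)
    {r : ℝ} (h : dInfty (projMeasure ν) (projMeasure μ) < r) :
    ∀ᵐ x ∂(μ : Measure (Sph d)), x ∈ ⋃ i, lineNhd b r i := by
  obtain ⟨γ, hγ, h⟩ := exists_coupling_of_dInfty_lt h
  refine ae_mem_lineNhd_of_coupling hν (swap_mem_couplings hγ) (r := r) ?_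
  refine (ae_map_iff measurable_swap.aemeasurable (measurableSet_rhoRP_lt r)).2 ?_
  filter_upwards [h] with p hp
  rw [rhoRP_comm]
  exact hp

theorem isOpen_dInfty_ball (μ : ProbabilityMeasure (RP d)) (r : ℝ) :
    IsOpen[dInftyTopology d] {ν | dInfty μ ν < r} :=
  TopologicalSpace.isOpen_generateFrom_of_mem ⟨μ, r, rfl⟩

/-! ### The threshold exponent and the connectedness argument -/

theorem thresholdExponent_ne_top : thresholdExponent d ≠ ⊤ :=
  (thresholdExponent_le_two.trans_lt (by simp)).ne

/-- The infimum need not be attained a priori, so the bound is obtained by letting the exponent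
decrease to it. -/
theorem doubleEnergy_thresholdExponent_le (h : 0 < thresholdExponent d)
    (μ : ProbabilityMeasure (Sph d)) :
    doubleEnergy (thresholdExponent d).toReal μ ≤ d / (d + 1) := by
  have hpos := ENNReal.toReal_pos h.ne' thresholdExponent_ne_top
  refine le_of_tendsto ((continuousAt_doubleEnergy_exponent hpos μ).tendsto.mono_left
    (nhdsWithin_le_nhds (s := Ioi (thresholdExponent d).toReal))) ?_
  filter_upwards [self_mem_nhdsWithin] with β hβ
  exact doubleEnergy_le_of_thresholdExponent_lt
    ((ENNReal.lt_ofReal_iff_toReal_lt thresholdExponent_ne_top).2 hβ) μ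

theorem mem_argmaxEnergy_thresholdExponent_iff (h : 0 < thresholdExponent d)
    (μ : ProbabilityMeasure (Sph d)) :
    μ ∈ argmaxEnergy d (thresholdExponent d) ↔
      (d : ℝ) / (d + 1) ≤ doubleEnergy (thresholdExponent d).toReal μ := by
  rw [mem_argmaxEnergy_iff thresholdExponent_ne_top]
  constructor
  · intro hμ
    obtain ⟨ν, hν⟩ := pDeltaEq_nonempty d
    rw [← (isEquidistributed_of_mem_PDeltaEq hν).doubleEnergy_eq
      (ENNReal.toReal_pos h.ne' thresholdExponent_ne_top)]
    exact hμ ν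
  · exact fun hμ ν => (doubleEnergy_thresholdExponent_le h ν).trans hμ

/-- The balls of the uniform radius r about equidistributions and about the other maximizers form
two open sets covering all maximizers; strict local maximality forbids a maximizer lying in both. -/
theorem isEquidistributed_of_isPreconnected (h1 : 1 < thresholdExponent d)
    (hconn : @IsPreconnected (ProbabilityMeasure (RP d)) (dInftyTopology d)
      (projMeasure '' argmaxEnergy d (thresholdExponent d)))
    {μ : ProbabilityMeasure (Sph d)} (hμ : μ ∈ argmaxEnergy d (thresholdExponent d)) :
    IsEquidistributed μ := by
  have h0 : 0 < thresholdExponent d := one_pos.trans h1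
  have h1' : 1 < (thresholdExponent d).toReal := by
    rw [← ENNReal.toReal_one]
    exact (ENNReal.toReal_lt_toReal ENNReal.one_ne_top thresholdExponent_ne_top).2 h1
  obtain ⟨r, hr, hloc⟩ := exists_radius_local_maximality (d := d) h1'
  have hE := mem_argmaxEnergy_thresholdExponent_iff h0
  by_contra hn
  obtain ⟨ν, hν⟩ := pDeltaEq_nonempty d
  have hνe := isEquidistributed_of_mem_PDeltaEq hν
  have hνm : ν ∈ argmaxEnergy d (thresholdExponent d) := by
    rw [hE, hνe.doubleEnergy_eq (by linarith)]
  obtain ⟨_, ⟨ξ, hξ, rfl⟩, hU, hV⟩ := hconn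
    (⋃ η ∈ {η : ProbabilityMeasure (Sph d) | IsEquidistributed η},
      {ζ | dInfty (projMeasure η) ζ < r})
    (⋃ η ∈ argmaxEnergy d (thresholdExponent d) \ {η | IsEquidistributed η},
      {ζ | dInfty (projMeasure η) ζ < r})
    (@isOpen_biUnion _ _ (dInftyTopology d) _ _ fun η _ => isOpen_dInfty_ball _ r)
    (@isOpen_biUnion _ _ (dInftyTopology d) _ _ fun η _ => isOpen_dInfty_ball _ r)
    (by
      rintro _ ⟨ξ, hξ, rfl⟩
      by_cases hξe : IsEquidistributed ξ
      · exact Or.inl (mem_biUnion (x := ξ) hξe (dInfty_self_lt _ hr))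
      · exact Or.inr (mem_biUnion (x := ξ) ⟨hξ, hξe⟩ (dInfty_self_lt _ hr)))
    ⟨_, mem_image_of_mem _ hνm, mem_biUnion (x := ν) hνe (dInfty_self_lt _ hr)⟩
    ⟨_, mem_image_of_mem _ hμ, mem_biUnion (x := μ) ⟨hμ, hn⟩ (dInfty_self_lt _ hr)⟩
  -- Local maximality is applied twice, from η to ξ and then from ξ to θ, so no triangle inequality
  -- for `dInfty` is needed.
  obtain ⟨η, ⟨b, hη⟩, hηξ⟩ := mem_iUnion₂.1 hU
  obtain ⟨b', hξe⟩ := (hloc b ξ (ae_mem_lineNhd_of_dInfty_lt' hη hηξ)).2 ((hE ξ).1 hξ)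
  obtain ⟨θ, ⟨hθ, hθn⟩, hθξ⟩ := mem_iUnion₂.1 hV
  exact hθn ((hloc b' θ (ae_mem_lineNhd_of_dInfty_lt hξe hθξ)).2 ((hE θ).1 hθ))

theorem thresholdExponent_le_one
    (hconn : @IsPreconnected (ProbabilityMeasure (RP d)) (dInftyTopology d)
      (projMeasure '' argmaxEnergy d (thresholdExponent d))) :
    thresholdExponent d ≤ 1 := by
  by_contra! h1
  have h0 : 0 < thresholdExponent d := one_pos.trans h1
  set a := (thresholdExponent d).toReal with ha
  have h1' : 1 < a := by
    rw [ha, ← ENNReal.toReal_one]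
    exact (ENNReal.toReal_lt_toReal ENNReal.one_ne_top thresholdExponent_ne_top).2 h1
  -- Local maximality will be used at this fixed β, so that one radius serves all α in (β, a).
  obtain ⟨β, hβ1, hβa⟩ := exists_between h1'
  have hgt : ∀ α : ℝ, ∃ μ : ProbabilityMeasure (Sph d), 0 < α →
      ∀ ν : ProbabilityMeasure (Sph d), doubleEnergy α ν ≤ doubleEnergy α μ := by
    intro α
    by_cases hα : 0 < α
    · obtain ⟨μ, hμ⟩ := exists_isMax_doubleEnergy (d := d) hα
      exact ⟨μ, fun _ => hμ⟩
    · exact ⟨(ponEq_nonempty d).some, fun h => absurd h hα⟩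
  choose M hM using hgt
  have hMc : ∀ α, 0 < α → α < a → (d : ℝ) / (d + 1) < doubleEnergy α (M α) := by
    intro α hα hαa
    obtain ⟨μ, hμ⟩ := exists_lt_doubleEnergy_of_lt_thresholdExponent hα
      ((ENNReal.ofReal_lt_iff_lt_toReal hα.le thresholdExponent_ne_top).2 hαa)
    exact hμ.trans_le (hM α hα μ)
  obtain ⟨μ, hμ⟩ := exists_clusterPt_of_compactSpace (map M (𝓝[<] a))
  -- For γ < α < a the energy of M α at γ is at least that at α. The narrow limit is thus taken at a
  -- fixed exponent γ, and only afterwards does γ increase to a.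
  have hμγ : ∀ γ, 0 < γ → γ < a → (d : ℝ) / (d + 1) ≤ doubleEnergy γ μ := by
    intro γ hγ hγa
    have hcl : IsClosed {ξ : ProbabilityMeasure (Sph d) | (d : ℝ) / (d + 1) ≤ doubleEnergy γ ξ} :=
      isClosed_le continuous_const (continuous_doubleEnergy hγ)
    refine isClosed_iff_clusterPt.1 hcl μ (hμ.mono (le_principal_iff.2 (mem_map.2 ?_)))
    filter_upwards [Ioo_mem_nhdsLT hγa] with α hα
    exact (hMc α (hγ.trans hα.1) hα.2).le.trans (doubleEnergy_anti hγ hα.1.le _)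
  have hμe : IsEquidistributed μ := by
    refine isEquidistributed_of_isPreconnected h1 hconn
      ((mem_argmaxEnergy_thresholdExponent_iff h0 μ).2 ?_)
    refine ge_of_tendsto ((continuousAt_doubleEnergy_exponent (by linarith : 0 < a) μ).tendsto.mono_left
      (nhdsWithin_le_nhds (s := Iio a))) ?_
    filter_upwards [Ioo_mem_nhdsLT hβa] with γ hγ
    exact hμγ γ (by linarith [hγ.1]) hγ.2
  obtain ⟨b, hb⟩ := hμe
  obtain ⟨r, hr, hloc⟩ := exists_radius_local_maximality (d := d) hβ1
  have hK : IsCompact (⋃ i, lineNhd b r i)ᶜ :=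
    (isOpen_iUnion fun i => isOpen_lineNhd b r i).isClosed_compl.isCompact
  have hlt : ∀ x ∈ (⋃ i, lineNhd b r i)ᶜ, potential β μ x < d / (d + 1) := by
    intro x hx
    by_contra! hge
    rw [potential_of_lines hb (by linarith), div_eq_inv_mul] at hge
    obtain ⟨i, hi⟩ := exists_Lambda_eq_zero_of_le_sum_rpow b hβ1
      (le_of_mul_le_mul_left hge (by positivity))
    exact hx (mem_iUnion.2 ⟨i, by rw [lineNhd, mem_ofPred_eq, hi]; exact hr⟩)
  -- Joint continuity of the potential and compactness carry the strict inequality from μ to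
  -- narrowly nearby measures, uniformly off the neighbourhoods.
  have hev : ∀ᶠ ξ in 𝓝 μ, ∀ x ∈ (⋃ i, lineNhd b r i)ᶜ, potential β ξ x < d / (d + 1) :=
    hK.eventually_forall_of_forall_eventually fun x hx =>
      (continuous_potential (by linarith)).continuousAt.eventually_lt continuousAt_const (hlt x hx)
  have hfreq : ∃ᶠ α in 𝓝[<] a, ∀ x ∈ (⋃ i, lineNhd b r i)ᶜ,
      potential β (M α) x < d / (d + 1) := (hμ.frequently hev)
  obtain ⟨α, hα, hαβ⟩ := (hfreq.and_eventually (Ioo_mem_nhdsLT hβa)).exists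
  have hα0 : 0 < α := by linarith [hαβ.1]
  have hβ0 : 0 < β := by linarith
  refine (hMc α hα0 hαβ.2).not_ge ((doubleEnergy_anti hβ0 hαβ.1.le _).trans (hloc b (M α) ?_).1)
  -- Almost everywhere the β-potential of M α is at least its α-potential, which equals an energy
  -- above d/(d+1); such points cannot lie off the neighbourhoods. This upgrades narrow closeness to
  -- confinement near the frame.
  filter_upwards [ae_potential_eq_of_isMax hα0 (hM α hα0)] with x hx
  by_contra hxn
  have h2 := hα x hxn
  have h3 := potential_anti hβ0 hαβ.1.le (M α) x
  rw [hx] at h3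
  linarith [hMc α hα0 hαβ.2]

end FejesToth
open FejesToth in
theorem corollary3p7 (d : ℕ) (hd : 1 ≤ d)
    (hconn : @IsPreconnected (ProbabilityMeasure (RP d)) (dInftyTopology d)
      (projMeasure '' argmaxEnergy d (thresholdExponent d))) :
    thresholdExponent d = 1 :=
  le_antisymm (thresholdExponent_le_one hconn) (one_le_thresholdExponent hd)
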